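/- Let $d\ge 0$ and $r\ge 1$ be integers, $0<p\le\infty$, and let $\|\cdot\|$ and $\cdot$ denote the Euclidean norm and inner product on $\mathbb R^{d+1}$, $\mathbb S^d$ its unit sphere. For $f:\mathbb R^{d+1}\to\mathbb R$ put $\triangle_\xi^r f(\eta)=\sum_{j=0}^r(-1)^{r+j}\binom rj f(\eta+j\xi)$, and for $G\subset\mathbb R^{d+1}$ let $\triangle^r_\xi(f,G,\eta)=\triangle^r_\xi f(\eta)$ if the segment $[\eta,\eta+r\xi]$ lies in $G$, and $\triangle^r_\xi(f,G,\eta)=0$ otherwise. (Only the values of $f$ on $G$ matter.) For $\mathcal E\subset\mathbb S^d$ let $$\omega^r(f,G;\mathcal E)_p=\sup_{\xi\in\mathcal E}\ \sup_{0<u\le \operatorname{diam}G}\ \|\triangle^r_{u\xi}(f,G,\cdot)\|_{L^p(G)} .$$ Let $\Pi_{r-1}(\mathcal E)$ be the set of all real algebraic polynomials $Q$ on $\mathbb R^{d+1}$ such that, for every $x\in\mathbb R^{d+1}$ and $e\in\mathcal E$, the function $t\mapsto Q(x+te)$ is a polynomial of degree $<r$ in $t\in\mathbb R$, and let $$E_{r-1}(f;\mathcal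 E)_{L^p(G)}=\inf\{\|f-Q\|_{L^p(G)}:\ Q\in\Pi_{r-1}(\mathcal E)\}.$$ Here $L^p(G)$ is taken with respect to Lebesgue measure, with the usual quasi-norm if $0<p<1$ and with the essential supremum norm if $p=\infty$ (so continuous functions on $G$ are included, and for them, on a convex body $G$, this is the uniform norm). A set $G\subset\mathbb R^{d+1}$ satisfies the cone condition with parameters $h>0$ and $\lambda\in(0,1)$ if for every $v\in G$ there is $u\in\mathbb S^d$ such that $$v+\{x\in\mathbb R^{d+1}:\ \lambda\|x\|\le x\cdot u\le h\}\subset G.$$ Theorem. Let $\mathcal E\subset\mathbb S^d$ be a set of $d+1$ directions that spans $\mathbb R^{d+1}$, and let $$\varepsilon_0=\varepsilon_0(\mathcal E)=\min_{\xi\in\mathbb S^d}\max_{\eta\in\mathcal E}|\xi\cdot\eta| .$$ Let $G\subset\mathbb R^{d+1}$ be a convex body (a compact convex set with non-empty interior) that satisfies the cone condition with parameters $h>0$ and $0<\lambda<\varepsilon_0/(4\sqrt r)$. Then for every $f\in L^p(G)$, $$E_{r-1}(f;\mathcal E)_{L^p(G)}\le C\,\omega^r(f,G;\mathcal E)_p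 ,$$ where $C$ depends only on $p,d,r,h,\operatorname{diam}G$ and, if $\varepsilon_0$ is close to zero, on $\varepsilon_0$; that is, for each $\varepsilon>0$ one constant $C=C(p,d,r,h,\operatorname{diam}G,\varepsilon)<\infty$ serves for all $\mathcal E$ with $\varepsilon_0(\mathcal E)\ge\varepsilon$. -/

import Mathlib

open MeasureTheory Set
open scoped ENNReal NNReal

noncomputable section

namespace DirectionalWhitney

/-- The `r`-th order finite difference
`∑_{j=0}^r (-1)^{r+j} (r choose j) f (η + j ξ)` with step `ξ` at the point `η`. -/
def fdiff {n : ℕ} (r : ℕ) (ξ : EuclideanSpace ℝ (Fin n)) (f : EuclideanSpace ℝ (Fin n) → ℝ)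
    (η : EuclideanSpace ℝ (Fin n)) : ℝ :=
  ∑ j ∈ Finset.range (r + 1), (-1 : ℝ) ^ (r + j) * (r.choose j : ℝ) * f (η + (j : ℝ) • ξ)

open Classical in
/-- The finite difference relative to a set `Ω`: it is the finite difference where the whole segment
`[η, η + r ξ]` lies in `Ω`, and zero elsewhere. -/
def fdiffOn {n : ℕ} (r : ℕ) (ξ : EuclideanSpace ℝ (Fin n)) (f : EuclideanSpace ℝ (Fin n) → ℝ)
    (Ω : Set (EuclideanSpace ℝ (Fin n))) (η : EuclideanSpace ℝ (Fin n)) : ℝ :=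
  if segment ℝ η (η + (r : ℝ) • ξ) ⊆ Ω then fdiff r ξ f η else 0

/-- The directional modulus of smoothness
`ω^r(f, t; 𝓔)_p = sup_{ξ ∈ 𝓔} sup_{0 < u ≤ t} ‖Δ^r_{u ξ}(f, Ω, ·)‖_{L^p(Ω)}`. -/
def modulusAt {n : ℕ} (r : ℕ) (f : EuclideanSpace ℝ (Fin n) → ℝ)
    (Ω : Set (EuclideanSpace ℝ (Fin n))) (t : ℝ) (𝓔 : Set (EuclideanSpace ℝ (Fin n)))
    (p : ℝ≥0∞) : ℝ≥0∞ :=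
  ⨆ ξ ∈ 𝓔, ⨆ u ∈ Ioc (0 : ℝ) t, eLpNorm (fdiffOn r (u • ξ) f Ω) p (volume.restrict Ω)

/-- `ω^r(f, Ω; 𝓔)_p = ω^r(f, diam Ω; 𝓔)_p`. -/
def modulus {n : ℕ} (r : ℕ) (f : EuclideanSpace ℝ (Fin n) → ℝ)
    (Ω : Set (EuclideanSpace ℝ (Fin n))) (𝓔 : Set (EuclideanSpace ℝ (Fin n)))
    (p : ℝ≥0∞) : ℝ≥0∞ :=
  modulusAt r f Ω (Metric.diam Ω) 𝓔 p

/-- The space `Π_{r-1}(𝓔)`: algebraic polynomials in `n` variables whose restriction to every line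
with direction in `𝓔` is a univariate polynomial of degree `< r`. -/
def dirPoly {n : ℕ} (r : ℕ) (𝓔 : Set (EuclideanSpace ℝ (Fin n))) :
    Set (MvPolynomial (Fin n) ℝ) :=
  {Q | ∀ x : EuclideanSpace ℝ (Fin n), ∀ e ∈ 𝓔, ∃ q : Polynomial ℝ, q.degree < (r : WithBot ℕ) ∧
    ∀ t : ℝ, MvPolynomial.eval (fun i => (x + t • e) i) Q = q.eval t}

/-- The error of best approximation `E_{r-1}(f; 𝓔)_{L^p(G)}` by elements of `Π_{r-1}(𝓔)`. -/
def bestError {n : ℕ} (r : ℕ) (f : EuclideanSpace ℝ (Fin n) → ℝ)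
    (𝓔 : Set (EuclideanSpace ℝ (Fin n))) (p : ℝ≥0∞) (G : Set (EuclideanSpace ℝ (Fin n))) : ℝ≥0∞ :=
  ⨅ Q ∈ dirPoly r 𝓔,
    eLpNorm (fun x => f x - MvPolynomial.eval (fun i => x i) Q) p (volume.restrict G)

/-- The cone with vertex `v`, direction `u`, height `h` and angle `arccos lam`. -/
def cone {n : ℕ} (v u : EuclideanSpace ℝ (Fin n)) (h lam : ℝ) : Set (EuclideanSpace ℝ (Fin n)) :=
  {y | ∃ x : EuclideanSpace ℝ (Fin n), lam * ‖x‖ ≤ inner ℝ x u ∧ inner ℝ x u ≤ h ∧ y = v + x}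

/-- The cone condition with parameters `h` and `lam`. -/
def ConeCondition {n : ℕ} (G : Set (EuclideanSpace ℝ (Fin n))) (h lam : ℝ) : Prop :=
  ∀ v ∈ G, ∃ u : EuclideanSpace ℝ (Fin n), ‖u‖ = 1 ∧ cone v u h lam ⊆ G

/-- `ε₀(𝓔) = min_{‖ξ‖ = 1} max_{η ∈ 𝓔} |ξ · η|`. -/
def eps0 {n : ℕ} (𝓔 : Set (EuclideanSpace ℝ (Fin n))) : ℝ :=
  ⨅ ξ : Metric.sphere (0 : EuclideanSpace ℝ (Fin n)) 1, ⨆ η : 𝓔,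
    |inner ℝ (ξ : EuclideanSpace ℝ (Fin n)) (η : EuclideanSpace ℝ (Fin n))|

end DirectionalWhitney

end

/-! The directions form a basis of unit vectors, so an affine change of variables turns them into
the coordinate directions, `G` into a convex set `H`, and `dirPoly` into the polynomials of degree
`< r` in each variable. The problem becomes a Whitney inequality for coordinate differences with a
constant uniform over all admissible `H`. The Jacobian scales both sides equally and cancels. The
bound `ε` controls the size of `H` (`norm_coord_le`), and the cone condition gives `StepProperty`:
from every point of `H`, `r` equal steps along some signed coordinate direction all land deep inside
`H`.

The argument has a local and a global half. Both rest on solving an `r`-th difference for its first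
value: `f x` is a combination of the values `f (x + j v)`, `1 ≤ j ≤ r`, plus plus or minus the
difference.

Global half: this identity carries an `L^p` bound from one cube to a slightly shifted one, hence
along segments to all of the core of `H`, and by one more use of `StepProperty` to `H` itself
(`exists_eLpNorm_le_of_stepProperty`).

Local half: functions on the unit cube with bounded norm and sufficiently small differences are
close to polynomials on a smaller cube. This is proved by compactness, in a form that covers `p <
1`, where averages of `f` itself may not exist. Using the identity in every coordinate gives `g x =
∑ a_m g (x + k_m u) + error` with every entry of `k_m` at least `1` (`ShiftRep`). The map `u ↦ x +
k_m u` then does not enlarge the measure of preimages, so exceptional sets stay small for most `u`.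
Hence smallness in measure improves to an `L^p` bound (`exists_eLpNorm_le_of_volume_le`), and a
sequence whose differences tend to zero is, along a subsequence, eventually bounded at almost every
point. After truncation, averaging over `u` against a Lipschitz weight gives equi-Lipschitz
functions. Arzelà–Ascoli yields a continuous limit, its differences vanish by Fatou, and such a
function is a polynomial.

Both halves together give a normalized statement, and homogeneity converts it into the inequality
(`exists_whitney`). -/

namespace CoordWhitney

/-! ### Coordinate differences and coordinate polynomials. -/

/-- The forward difference of order `r` with step `v`. -/
def finDiff {V : Type*} [AddCommGroup V] [Module ℝ V] (r : ℕ) (v : V) (f : V → ℝ) (x : V) : ℝ :=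
  ∑ j ∈ Finset.range (r + 1), (-1 : ℝ) ^ (r + j) * (r.choose j : ℝ) * f (x + (j : ℝ) • v)

/-- All `r`-th differences of `f` in coordinate directions, taken inside `H`, have `L^p` norm at
most `ω`. -/
def DiffBound {n : ℕ} (H : Set (Fin n → ℝ)) (r : ℕ) (f : (Fin n → ℝ) → ℝ) (p ω : ℝ≥0∞) : Prop :=
  ∀ (i : Fin n) (u : ℝ), eLpNorm (finDiff r (Pi.single i u) f) p
    (volume.restrict {x | x ∈ H ∧ x + (r : ℝ) • Pi.single i u ∈ H}) ≤ ω

/-- Polynomials of degree less than `r` in each variable. -/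
def coordPoly (n r : ℕ) : Set (MvPolynomial (Fin n) ℝ) :=
  {P | ∀ (y : Fin n → ℝ) (i : Fin n), ∃ q : Polynomial ℝ, q.degree < (r : WithBot ℕ) ∧
    ∀ t : ℝ, MvPolynomial.eval (y + Pi.single i t) P = q.eval t}

/-! ### Quasi-norm estimates valid for every positive exponent. -/

/-- The quasi-triangle inequality is iterated. What matters is that the constant depends only on the
coefficients and `p`, not on the measure or the functions. -/
theorem exists_eLpNorm_sum_le {ι : Type*} (s : Finset ι) (a : ι → ℝ) (p : ℝ≥0∞) :
    ∃ C : ℝ≥0, ∀ {α : Type} [MeasurableSpace α] (μ : Measure α) (F : ι → α → ℝ) (W : ℝ≥0∞),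
      (∀ m ∈ s, AEStronglyMeasurable (F m) μ) → (∀ m ∈ s, eLpNorm (F m) p μ ≤ W) →
      eLpNorm (fun x => ∑ m ∈ s, a m * F m x) p μ ≤ C * W := by
  classical
  induction s using Finset.induction_on with
  | empty => exact ⟨0, fun μ F W _ _ => by simp⟩
  | insert m s hm ih =>
    obtain ⟨C, hC⟩ := ih
    refine ⟨(ENNReal.LpAddConst p).toNNReal * (‖a m‖₊ + C), fun μ F W hF hW => ?_⟩
    have h1 : (fun x => ∑ m ∈ insert m s, a m * F m x)
        = (a m • F m) + (fun x => ∑ m ∈ s, a m * F m x) := by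
      ext x; simp [Finset.sum_insert hm]
    rw [h1]
    have hms : AEStronglyMeasurable (a m • F m) μ :=
      (hF m (Finset.mem_insert_self _ _)).const_smul _
    have hss : AEStronglyMeasurable (fun x => ∑ m ∈ s, a m * F m x) μ := by
      refine Finset.aestronglyMeasurable_fun_sum s fun k hk => ?_
      exact (hF k (Finset.mem_insert_of_mem hk)).const_mul _
    refine (eLpNorm_add_le' hms hss p).trans ?_
    rw [ENNReal.coe_mul, ENNReal.coe_toNNReal (ENNReal.LpAddConst_lt_top p).ne, mul_assoc,
      ENNReal.coe_add, add_mul]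
    gcongr
    · rw [eLpNorm_const_smul]
      exact mul_le_mul' le_rfl (hW m (Finset.mem_insert_self _ _))
    · exact hC μ F W (fun k hk => hF k (Finset.mem_insert_of_mem hk))
        (fun k hk => hW k (Finset.mem_insert_of_mem hk))

theorem eLpNorm_comp_le_of_map_le {α β : Type*} [MeasurableSpace α] [MeasurableSpace β]
    {μ : Measure α} {ν : Measure β} {T : α → β} (hT : MeasurableEmbedding T)
    (h : μ.map T ≤ ν) (g : β → ℝ) (p : ℝ≥0∞) :
    eLpNorm (fun x => g (T x)) p μ ≤ eLpNorm g p ν := by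
  have := hT.eLpNorm_map_measure (g := g) (p := p) (μ := μ)
  rw [show (fun x => g (T x)) = g ∘ T from rfl, ← this]
  exact eLpNorm_mono_measure _ h

theorem eLpNorm_translate_le {V : Type*} [AddGroup V] [MeasureSpace V] [MeasurableAdd V]
    [(volume : Measure V).IsAddRightInvariant] (v : V) {A B : Set V}
    (h : ∀ x ∈ A, x + v ∈ B) (g : V → ℝ) (p : ℝ≥0∞) :
    eLpNorm (fun x => g (x + v)) p (volume.restrict A) ≤ eLpNorm g p (volume.restrict B) := by
  have hT : MeasurableEmbedding (fun x : V => x + v) := measurableEmbedding_addRight v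
  refine eLpNorm_comp_le_of_map_le hT ?_ g p
  calc (volume.restrict A).map (fun x => x + v)
      ≤ (volume.restrict ((fun x => x + v) ⁻¹' B)).map (fun x => x + v) :=
        Measure.map_mono (Measure.restrict_mono h le_rfl) hT.measurable
    _ = volume.restrict B := by
        rw [← hT.restrict_map, map_add_right_eq_self]

theorem exists_eLpNorm_biUnion_le (N : ℕ) {p : ℝ≥0∞} (hp : p ≠ 0) :
    ∃ C : ℝ≥0, ∀ {ι : Type} (s : Finset ι) {α : Type} [MeasurableSpace α] (μ : Measure α)
      (A : ι → Set α) (g : α → ℝ) (W : ℝ≥0∞), s.card ≤ N →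
      (∀ m ∈ s, eLpNorm g p (μ.restrict (A m)) ≤ W) →
      eLpNorm g p (μ.restrict (⋃ m ∈ s, A m)) ≤ C * W := by
  refine ⟨(N : ℝ≥0) ^ (1 / p.toReal), fun s α _ μ A g W hs hW => ?_⟩
  rcases eq_or_ne p ∞ with rfl | hp'
  · simp only [ENNReal.toReal_top, div_zero, NNReal.rpow_zero, ENNReal.coe_one, one_mul]
    simp only [eLpNorm_exponent_top] at hW ⊢
    refine eLpNormEssSup_le_of_ae_enorm_bound ?_
    rw [ae_restrict_biUnion_finset_iff]
    intro m hm
    filter_upwards [enorm_ae_le_eLpNormEssSup g (μ.restrict (A m))] with x hx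
    exact hx.trans (hW m hm)
  · have hpos : 0 < p.toReal := ENNReal.toReal_pos hp hp'
    have hW' : ∀ m ∈ s, ∫⁻ x in A m, ‖g x‖ₑ ^ p.toReal ∂μ ≤ W ^ p.toReal := by
      intro m hm
      have := hW m hm
      rw [eLpNorm_eq_lintegral_rpow_enorm_toReal hp hp', one_div,
        ENNReal.rpow_inv_le_iff hpos] at this
      exact this
    rw [eLpNorm_eq_lintegral_rpow_enorm_toReal hp hp', one_div, ENNReal.rpow_inv_le_iff hpos,
      ENNReal.mul_rpow_of_nonneg _ _ hpos.le, ENNReal.coe_rpow_of_nonneg _ (by positivity),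
      ← ENNReal.rpow_mul, inv_mul_cancel₀ hpos.ne', ENNReal.rpow_one]
    calc ∫⁻ x in ⋃ m ∈ s, A m, ‖g x‖ₑ ^ p.toReal ∂μ
        ≤ ∑ m ∈ s, ∫⁻ x in A m, ‖g x‖ₑ ^ p.toReal ∂μ := by
          classical
          clear hW hW' hs
          induction s using Finset.induction_on with
          | empty => simp
          | insert m s hm ih =>
            rw [Finset.sum_insert hm, Finset.set_biUnion_insert]
            refine (lintegral_union_le _ _ _).trans ?_
            gcongr
    _ ≤ ∑ m ∈ s, W ^ p.toReal := Finset.sum_le_sum hW'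
    _ = s.card * W ^ p.toReal := by simp
    _ ≤ ((N : ℝ≥0) : ℝ≥0∞) * W ^ p.toReal := by
      gcongr
      exact_mod_cast hs

/-! ### Algebra of finite differences. -/

theorem DiffBound.mono {n r : ℕ} {H H' : Set (Fin n → ℝ)} {f : (Fin n → ℝ) → ℝ} {p ω : ℝ≥0∞}
    (h : DiffBound H r f p ω) (hH : H' ⊆ H) : DiffBound H' r f p ω := fun i u =>
  (eLpNorm_mono_measure _ (Measure.restrict_mono
    (fun _ (hx : _ ∧ _) => And.intro (hH hx.1) (hH hx.2)) le_rfl)).trans (h i u)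

theorem finDiff_polynomial {r : ℕ} {q : Polynomial ℝ} (hq : q.degree < (r : WithBot ℕ)) (x u : ℝ) :
    finDiff r u (fun t => q.eval t) x = 0 := by
  rcases eq_or_ne q 0 with rfl | hq0
  · simp [finDiff]
  have hd : (q.comp (Polynomial.C x + Polynomial.C u * Polynomial.X)).natDegree < r := by
    refine Polynomial.natDegree_comp_le.trans_lt ?_
    have h1 : q.natDegree < r := (Polynomial.natDegree_lt_iff_degree_lt hq0).2 hq
    have h2 : (Polynomial.C x + Polynomial.C u * Polynomial.X).natDegree ≤ 1 := by
      compute_degree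
    nlinarith
  have h := congrFun (Polynomial.fwdDiff_iter_eq_zero_of_degree_lt hd) 0
  rw [fwdDiff_iter_eq_sum_shift] at h
  rw [Pi.zero_apply] at h
  rw [← h, finDiff]
  refine Finset.sum_congr rfl fun j hj => ?_
  have hj' : j ≤ r := Nat.lt_succ_iff.1 (Finset.mem_range.1 hj)
  have hs : (-1 : ℝ) ^ (r + j) = (-1) ^ (r - j) := by
    rw [show r + j = (r - j) + 2 * j by omega, pow_add, pow_mul]; simp
  simp [hs, mul_comm u]

theorem finDiff_coordPoly {n r : ℕ} {P : MvPolynomial (Fin n) ℝ} (hP : P ∈ coordPoly n r)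
    (i : Fin n) (u : ℝ) (x : Fin n → ℝ) :
    finDiff r (Pi.single i u) (fun y => MvPolynomial.eval y P) x = 0 := by
  obtain ⟨q, hq, hqe⟩ := hP x i
  have := finDiff_polynomial hq 0 u
  rw [← this]
  simp only [finDiff, ← Pi.single_smul, hqe, zero_add]

theorem finDiff_sub {V : Type*} [AddCommGroup V] [Module ℝ V] (r : ℕ) (v : V) (f g : V → ℝ)
    (x : V) :
    finDiff r v (fun y => f y - g y) x = finDiff r v f x - finDiff r v g x := by
  simp only [finDiff, ← Finset.sum_sub_distrib, mul_sub]

theorem finDiff_const_mul {V : Type*} [AddCommGroup V] [Module ℝ V] (r : ℕ) (v : V) (c : ℝ)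
    (f : V → ℝ) (x : V) : finDiff r v (fun y => c * f y) x = c * finDiff r v f x := by
  simp only [finDiff, Finset.mul_sum]
  exact Finset.sum_congr rfl fun j _ => by ring

/-- The difference solved for its `j = 0` term. All later propagation and representation arguments
rest on this identity. -/
theorem finDiff_eq_add {V : Type*} [AddCommGroup V] [Module ℝ V] (r : ℕ) (v : V) (f : V → ℝ)
    (x : V) : f x = (-1) ^ r * finDiff r v f x +
      ∑ j ∈ Finset.Icc 1 r, (-(-1 : ℝ) ^ j * (r.choose j : ℝ)) * f (x + (j : ℝ) • v) := by
  have h : Finset.range (r + 1) = insert 0 (Finset.Icc 1 r) := by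
    ext j; simp; omega
  rw [finDiff, h, Finset.sum_insert (by simp), mul_add, Finset.mul_sum, add_assoc,
    ← Finset.sum_add_distrib]
  have e : (-1 : ℝ) ^ r * (-1) ^ r = 1 := by rw [← mul_pow]; simp
  rw [Finset.sum_eq_zero]
  · simp [← mul_assoc, e]
  · intro j _
    rw [pow_add]
    linear_combination ((-1) ^ j * (r.choose j : ℝ) * f (x + (j : ℝ) • v)) * e

theorem Measurable.finDiff {n r : ℕ} {f : (Fin n → ℝ) → ℝ} (hf : Measurable f) (v : Fin n → ℝ) :
    Measurable (finDiff r v f) := by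
  unfold CoordWhitney.finDiff
  fun_prop

theorem DiffBound.sub_coordPoly {n r : ℕ} {H : Set (Fin n → ℝ)} {f : (Fin n → ℝ) → ℝ}
    {p ω : ℝ≥0∞} (h : DiffBound H r f p ω) {P : MvPolynomial (Fin n) ℝ} (hP : P ∈ coordPoly n r) :
    DiffBound H r (fun x => f x - MvPolynomial.eval x P) p ω := by
  intro i u
  refine le_trans (le_of_eq ?_) (h i u)
  congr 1
  ext x
  rw [finDiff_sub, finDiff_coordPoly hP, sub_zero]

theorem DiffBound.const_mul {n r : ℕ} {H : Set (Fin n → ℝ)} {f : (Fin n → ℝ) → ℝ}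
    {p ω : ℝ≥0∞} (h : DiffBound H r f p ω) (c : ℝ) :
    DiffBound H r (fun x => c * f x) p (‖c‖ₑ * ω) := by
  intro i u
  have : finDiff r (Pi.single i u) (fun x => c * f x) = c • finDiff r (Pi.single i u) f := by
    ext x; simp [finDiff_const_mul]
  rw [this, eLpNorm_const_smul]
  exact mul_le_mul' le_rfl (h i u)

theorem add_mem_coordPoly {n r : ℕ} {P Q : MvPolynomial (Fin n) ℝ} (hP : P ∈ coordPoly n r)
    (hQ : Q ∈ coordPoly n r) : P + Q ∈ coordPoly n r := by
  intro y i
  obtain ⟨q, hq, hqe⟩ := hP y i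
  obtain ⟨q', hq', hqe'⟩ := hQ y i
  exact ⟨q + q', (Polynomial.degree_add_le _ _).trans_lt (max_lt hq hq'), fun t => by
    simp [hqe, hqe']⟩

theorem C_mul_mem_coordPoly {n r : ℕ} {P : MvPolynomial (Fin n) ℝ} (hP : P ∈ coordPoly n r)
    (c : ℝ) : MvPolynomial.C c * P ∈ coordPoly n r := by
  intro y i
  obtain ⟨q, hq, hqe⟩ := hP y i
  refine ⟨Polynomial.C c * q, ?_, fun t => by simp [hqe]⟩
  rw [← Polynomial.smul_eq_C_mul]
  exact (Polynomial.degree_smul_le _ _).trans_lt hq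

/-! ### Propagation of norm bounds through a convex set. -/

/-- By `finDiff_eq_add`, values on `A` are controlled by the difference and by values at the points
reached after `1, …, r` steps, which all lie in `B`. -/
theorem exists_eLpNorm_le_of_step (r : ℕ) (p : ℝ≥0∞) :
    ∃ C : ℝ≥0, ∀ {n : ℕ} {H A B : Set (Fin n → ℝ)} {g : (Fin n → ℝ) → ℝ} {ω W : ℝ≥0∞}
      (i : Fin n) (u : ℝ), Measurable g → DiffBound H r g p ω →
      (∀ x ∈ A, x ∈ H ∧ x + (r : ℝ) • Pi.single i u ∈ H) →
      (∀ x ∈ A, ∀ j ∈ Finset.Icc 1 r, x + (j : ℝ) • Pi.single i u ∈ B) →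
      eLpNorm g p (volume.restrict B) ≤ W →
      eLpNorm g p (volume.restrict A) ≤ C * (W + ω) := by
  obtain ⟨C, hC⟩ := exists_eLpNorm_sum_le (insert 0 (Finset.Icc 1 r))
    (fun j : ℕ => if j = 0 then (-1 : ℝ) ^ r else -(-1 : ℝ) ^ j * (r.choose j : ℝ)) p
  refine ⟨C, fun {n H A B g ω W} i u hg hd hA hB hW => ?_⟩
  have h := hC (volume.restrict A) (fun (j : ℕ) x => if j = 0 then
    finDiff r (Pi.single i u) g x else g (x + (j : ℝ) • Pi.single i u)) (W + ω) ?_ ?_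
  · refine le_of_eq_of_le ?_ h
    congr 1
    ext x
    rw [Finset.sum_insert (by simp), finDiff_eq_add r (Pi.single i u) g x]
    simp only [if_true]
    congr 1
    refine Finset.sum_congr rfl fun j hj => ?_
    have : j ≠ 0 := by have := (Finset.mem_Icc.1 hj).1; omega
    simp [this]
  · intro j _
    have := Measurable.finDiff hg (r := r) (Pi.single i u)
    split_ifs
    · exact this.aestronglyMeasurable
    · exact (hg.comp (measurable_add_const _)).aestronglyMeasurable
  · intro j hj
    split_ifs with h0
    · refine le_trans ?_ ((hd i u).trans le_add_self)
      exact eLpNorm_mono_measure _ (Measure.restrict_mono (fun x hx => hA x hx) le_rfl)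
    · refine le_trans (eLpNorm_translate_le _ (fun x hx => hB x hx j ?_) g p) (hW.trans le_self_add)
      simpa [h0] using hj

/-- Balls are cubes in the sup norm. The part of the shifted cube behind the old centre already lies
in the old cube. From the part ahead of it, whose `i`-th offset is at most `a + a / r`, any of the
`r` backward steps of length `a / r` lands in the old cube. -/
theorem exists_eLpNorm_closedBall_shift_single_le (r : ℕ) (hr : 1 ≤ r) {p : ℝ≥0∞} (hp : p ≠ 0) :
    ∃ C : ℝ≥0, ∀ {n : ℕ} {H : Set (Fin n → ℝ)} {g : (Fin n → ℝ) → ℝ} {ω W : ℝ≥0∞} {a t : ℝ}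
      (y : Fin n → ℝ) (i : Fin n), Measurable g → DiffBound H r g p ω →
      0 < a → |t| ≤ a / r → Metric.closedBall y a ⊆ H →
      Metric.closedBall (y + Pi.single i t) a ⊆ H →
      eLpNorm g p (volume.restrict (Metric.closedBall y a)) ≤ W →
      eLpNorm g p (volume.restrict (Metric.closedBall (y + Pi.single i t) a)) ≤ C * (W + ω) := by
  obtain ⟨C, hC⟩ := exists_eLpNorm_le_of_step r p
  obtain ⟨C', hC'⟩ := exists_eLpNorm_biUnion_le 2 hp
  refine ⟨C' * (C + 1), fun {n H g ω W a t} y i hg hd ha ht hy hy' hW => ?_⟩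
  have hr0 : (0 : ℝ) < r := by exact_mod_cast hr
  obtain ⟨σ, hσ, hσt⟩ : ∃ σ : ℝ, (σ = 1 ∨ σ = -1) ∧ t = σ * |t| := by
    rcases le_total 0 t with h | h
    · exact ⟨1, Or.inl rfl, by rw [abs_of_nonneg h]; ring⟩
    · exact ⟨-1, Or.inr rfl, by rw [abs_of_nonpos h]; ring⟩
  have hmem : ∀ x z : Fin n → ℝ, x ∈ Metric.closedBall z a ↔ ∀ k, |x k - z k| ≤ a := by
    intro x z
    rw [Metric.mem_closedBall, dist_pi_le_iff ha.le]
    rfl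
  set A : Set (Fin n → ℝ) := {x | x ∈ Metric.closedBall (y + Pi.single i t) a ∧
    0 ≤ σ * (x i - y i)} with hA
  have hstep : ∀ x ∈ A, ∀ j ∈ Finset.Icc 1 r,
      x + (j : ℝ) • Pi.single i (-σ * (a / r)) ∈ Metric.closedBall y a := by
    rintro x ⟨hx, hxi⟩ j hj
    obtain ⟨hj1, hjr⟩ := Finset.mem_Icc.1 hj
    rw [hmem] at hx ⊢
    intro k
    have hk := hx k
    rcases eq_or_ne k i with rfl | hki
    · have h1 : (j : ℝ) * (a / r) ≤ a := by
        rw [← mul_div_assoc, div_le_iff₀ hr0, mul_comm]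
        gcongr
      have h2 : a / r ≤ (j : ℝ) * (a / r) := by
        have : (1 : ℝ) ≤ j := by exact_mod_cast hj1
        exact le_mul_of_one_le_left (by positivity) this
      simp only [Pi.add_apply, Pi.single_eq_same, Pi.smul_apply, smul_eq_mul] at hk ⊢
      rw [abs_le] at hk ⊢
      have h0 := abs_nonneg t
      rcases hσ with rfl | rfl
      · constructor <;> nlinarith
      · constructor <;> nlinarith
    · simpa [hki] using hk
  have hApart : eLpNorm g p (volume.restrict A) ≤ C * (W + ω) := by
    refine hC i (-σ * (a / r)) hg hd (fun x hx => ⟨hy' hx.1, hy ?_⟩) hstep hW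
    exact hstep x hx r (by simp [hr])
  have hcov : Metric.closedBall (y + Pi.single i t) a ⊆
      ⋃ b ∈ (Finset.univ : Finset Bool), (if b then A else Metric.closedBall y a) := by
    intro x hx
    simp only [Finset.mem_univ, iUnion_true, mem_iUnion, Bool.exists_bool, Bool.false_eq_true,
      if_false, if_true]
    by_cases hxi : 0 ≤ σ * (x i - y i)
    · exact Or.inr ⟨hx, hxi⟩
    · left
      rw [hmem] at hx ⊢
      intro k
      have hk := hx k
      rcases eq_or_ne k i with rfl | hki
      · simp only [Pi.add_apply, Pi.single_eq_same] at hk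
        rw [abs_le] at hk ⊢
        have h0 := abs_nonneg t
        rcases hσ with rfl | rfl
        · constructor <;> nlinarith
        · constructor <;> nlinarith
      · simpa [hki] using hk
  refine (eLpNorm_mono_measure _ (Measure.restrict_mono hcov le_rfl)).trans ?_
  refine (hC' Finset.univ volume _ g ((C + 1) * (W + ω)) (by simp) ?_).trans (by
    push_cast; rw [mul_assoc])
  intro b _
  cases b
  · simp only [Bool.false_eq_true, if_false]
    refine hW.trans ((le_self_add (b := ω)).trans ?_)
    exact le_mul_of_one_le_left' le_add_self
  · simp only [if_true]
    exact hApart.trans (mul_le_mul_left le_self_add _)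

theorem exists_eLpNorm_closedBall_shift_le (n r : ℕ) (hr : 1 ≤ r) {p : ℝ≥0∞} (hp : p ≠ 0) :
    ∃ C : ℝ≥0, ∀ {H : Set (Fin n → ℝ)} {g : (Fin n → ℝ) → ℝ} {ω W : ℝ≥0∞} {a : ℝ}
      (y z : Fin n → ℝ), Measurable g → DiffBound H r g p ω →
      0 < a → ‖z‖ ≤ a / r → Metric.closedBall y (2 * a) ⊆ H →
      eLpNorm g p (volume.restrict (Metric.closedBall y a)) ≤ W →
      eLpNorm g p (volume.restrict (Metric.closedBall (y + z) a)) ≤ C * (W + ω) := by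
  classical
  obtain ⟨C, hC⟩ := exists_eLpNorm_closedBall_shift_single_le r hr hp
  suffices h : ∀ S : Finset (Fin n), ∃ C : ℝ≥0, ∀ {H : Set (Fin n → ℝ)} {g : (Fin n → ℝ) → ℝ}
      {ω W : ℝ≥0∞} {a : ℝ} (y z : Fin n → ℝ), Measurable g → DiffBound H r g p ω →
      0 < a → ‖z‖ ≤ a / r → Metric.closedBall y (2 * a) ⊆ H →
      eLpNorm g p (volume.restrict (Metric.closedBall y a)) ≤ W →
      eLpNorm g p (volume.restrict (Metric.closedBall (y + S.piecewise z 0) a)) ≤ C * (W + ω) by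
    simpa using h Finset.univ
  intro S
  induction S using Finset.induction_on with
  | empty =>
    refine ⟨1, fun y z hg hd ha hz hy hW => ?_⟩
    simpa using hW.trans le_self_add
  | insert i S hi ih =>
    obtain ⟨K, hK⟩ := ih
    refine ⟨C * (K + 1), fun {H g ω W a} y z hg hd ha hz hy hW => ?_⟩
    have hr1 : (1 : ℝ) ≤ r := by exact_mod_cast hr
    have har : a / r ≤ a := div_le_self ha.le hr1
    have hsub : ∀ T : Finset (Fin n),
        Metric.closedBall (y + T.piecewise z 0) a ⊆ Metric.closedBall y (2 * a) := by
      intro T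
      refine Metric.closedBall_subset_closedBall' ?_
      have : ‖T.piecewise z 0‖ ≤ a := by
        refine (pi_norm_le_iff_of_nonneg ha.le).2 fun k => ?_
        by_cases hk : k ∈ T
        · simpa [hk] using (norm_le_pi_norm z k).trans (hz.trans har)
        · simpa [hk] using ha.le
      rw [dist_eq_norm, add_sub_cancel_left]
      linarith
    have heq : y + (insert i S).piecewise z 0 = y + S.piecewise z 0 + Pi.single i (z i) := by
      rw [add_assoc]
      congr 1
      ext k
      rcases eq_or_ne k i with rfl | hki
      · simp [hi]
      · by_cases hk : k ∈ S <;> simp [hki, hk]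
    have hb := hC (t := z i) (y + S.piecewise z 0) i hg hd ha
      ((norm_le_pi_norm z i).trans hz) ((hsub S).trans hy)
      (by rw [← heq]; exact (hsub _).trans hy) (hK y z hg hd ha hz hy hW)
    rw [heq]
    refine hb.trans ?_
    push_cast
    rw [mul_assoc, add_mul, one_mul]
    gcongr
    exact le_add_self

theorem exists_eLpNorm_closedBall_chain_le (n r : ℕ) (hr : 1 ≤ r) {p : ℝ≥0∞} (hp : p ≠ 0) (N : ℕ) :
    ∃ C : ℝ≥0, ∀ {H : Set (Fin n → ℝ)} {g : (Fin n → ℝ) → ℝ} {ω W : ℝ≥0∞} {a : ℝ}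
      (y : ℕ → Fin n → ℝ), Measurable g → DiffBound H r g p ω →
      0 < a → (∀ k < N, ‖y (k + 1) - y k‖ ≤ a / r) →
      (∀ k < N, Metric.closedBall (y k) (2 * a) ⊆ H) →
      eLpNorm g p (volume.restrict (Metric.closedBall (y 0) a)) ≤ W →
      eLpNorm g p (volume.restrict (Metric.closedBall (y N) a)) ≤ C * (W + ω) := by
  obtain ⟨C, hC⟩ := exists_eLpNorm_closedBall_shift_le n r hr hp
  induction N with
  | zero =>
    exact ⟨1, fun y hg hd ha hz hy hW => by simpa using hW.trans le_self_add⟩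
  | succ N ih =>
    obtain ⟨K, hK⟩ := ih
    refine ⟨C * (K + 1), fun {H g ω W a} y hg hd ha hz hy hW => ?_⟩
    have hb := hC (y N) (y (N + 1) - y N) hg hd ha (hz N (Nat.lt_succ_self N))
      (hy N (Nat.lt_succ_self N)) (hK y hg hd ha (fun k hk => hz k (hk.trans (Nat.lt_succ_self N)))
      (fun k hk => hy k (hk.trans (Nat.lt_succ_self N))) hW)
    rw [add_sub_cancel] at hb
    refine hb.trans ?_
    push_cast
    rw [mul_assoc, add_mul, one_mul]
    gcongr
    exact le_add_self

theorem Convex.setOf_closedBall_subset {V : Type*} [NormedAddCommGroup V] [NormedSpace ℝ V]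
    {H : Set V} (hH : Convex ℝ H) (a : ℝ) : Convex ℝ {y | Metric.closedBall y a ⊆ H} := by
  intro y hy y' hy' α β hα hβ hαβ z hz
  have hw : ‖z - (α • y + β • y')‖ ≤ a := by rwa [← dist_eq_norm]
  have : z = α • (y + (z - (α • y + β • y'))) + β • (y' + (z - (α • y + β • y'))) := by
    have : z - (α • y + β • y') = (α + β) • (z - (α • y + β • y')) := by rw [hαβ, one_smul]
    rw [smul_add, smul_add, add_add_add_comm, ← add_smul, hαβ, one_smul]
    abel
  rw [this]
  refine hH (hy ?_) (hy' ?_) hα hβ hαβ <;> simpa [dist_eq_norm] using hw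

/-- The core is convex, so each of its points is joined to `y₀` by a segment inside it. The number
of steps and the number of covering balls depend on `D`, `a`, `r`, `n` only, so the constant is
uniform in `H`. -/
theorem exists_eLpNorm_core_le (n r : ℕ) (hr : 1 ≤ r) {p : ℝ≥0∞} (hp : p ≠ 0) {a D : ℝ}
    (ha : 0 < a) :
    ∃ C : ℝ≥0, ∀ {H : Set (Fin n → ℝ)} {g : (Fin n → ℝ) → ℝ} {ω W : ℝ≥0∞} (y₀ : Fin n → ℝ),
      Convex ℝ H → H ⊆ Metric.closedBall 0 D → Measurable g → DiffBound H r g p ω →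
      Metric.closedBall y₀ (2 * a) ⊆ H →
      eLpNorm g p (volume.restrict (Metric.closedBall y₀ a)) ≤ W →
      eLpNorm g p (volume.restrict {y | Metric.closedBall y (2 * a) ⊆ H}) ≤ C * (W + ω) := by
  classical
  have hr0 : (0 : ℝ) < r := by exact_mod_cast hr
  -- Two core points are at distance at most `2 * D`, so `N` equal pieces of the segment have length
  -- at most `a / r`.
  obtain ⟨N, hN⟩ := exists_nat_gt (max 0 (2 * D / (a / r)))
  obtain ⟨C, hC⟩ := exists_eLpNorm_closedBall_chain_le n r hr hp N
  obtain ⟨t, -, htf, ht⟩ := (isCompact_closedBall (0 : Fin n → ℝ) D).finite_cover_balls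
    (half_pos ha)
  obtain ⟨C', hC'⟩ := exists_eLpNorm_biUnion_le htf.toFinset.card hp
  refine ⟨C' * C, fun {H g ω W} y₀ hH hHD hg hd hy₀ hW => ?_⟩
  have hN0 : (0 : ℝ) < N := (le_max_left _ _).trans_lt hN
  have hND : 2 * D ≤ a / r * N := by
    have := (le_max_right _ _).trans_lt hN
    rw [div_lt_iff₀ (by positivity)] at this
    linarith
  have hconv := Convex.setOf_closedBall_subset hH (2 * a)
  have hcD : ∀ y, Metric.closedBall y (2 * a) ⊆ H → ‖y‖ ≤ D := fun y hy => by
    simpa using hHD (hy (Metric.mem_closedBall_self (by positivity)))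
  have hsingle : ∀ y, Metric.closedBall y (2 * a) ⊆ H →
      eLpNorm g p (volume.restrict (Metric.closedBall y a)) ≤ C * (W + ω) := by
    intro y hy
    have h := hC (fun k : ℕ => y₀ + ((k : ℝ) / N) • (y - y₀)) hg hd ha ?_ ?_ (by simpa using hW)
    · simpa [div_self hN0.ne'] using h
    · intro k hk
      have : y₀ + (((k + 1 : ℕ) : ℝ) / N) • (y - y₀) - (y₀ + ((k : ℝ) / N) • (y - y₀))
          = ((N : ℝ)⁻¹) • (y - y₀) := by
        rw [add_sub_add_left_eq_sub, ← sub_smul]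
        congr 1
        push_cast
        field_simp
        ring
      rw [this, norm_smul, Real.norm_of_nonneg (by positivity), inv_mul_le_iff₀ hN0]
      have h1 := norm_sub_le y y₀
      have h2 := hcD y hy
      have h3 := hcD y₀ hy₀
      linarith
    · intro k hk
      have hkN : (k : ℝ) / N ≤ 1 := by
        rw [div_le_one hN0]; exact_mod_cast hk.le
      exact hconv.add_smul_sub_mem hy₀ hy ⟨by positivity, hkN⟩
  -- A centre of the cover need not lie in the core. It is replaced by a core point within `a / 2`,
  -- and radius `a` then still covers.
  let A : (Fin n → ℝ) → Set (Fin n → ℝ) := fun x =>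
    if h : ∃ y, Metric.closedBall y (2 * a) ⊆ H ∧ y ∈ Metric.ball x (a / 2) then
      Metric.closedBall h.choose a else ∅
  have hcov : {y | Metric.closedBall y (2 * a) ⊆ H} ⊆ ⋃ x ∈ htf.toFinset, A x := by
    intro y hy
    have hyD : y ∈ Metric.closedBall (0 : Fin n → ℝ) D := by simpa using hcD y hy
    obtain ⟨x, hx, hyx⟩ := mem_iUnion₂.1 (ht hyD)
    refine mem_iUnion₂.2 ⟨x, htf.mem_toFinset.2 hx, ?_⟩
    have hex : ∃ y, Metric.closedBall y (2 * a) ⊆ H ∧ y ∈ Metric.ball x (a / 2) := ⟨y, hy, hyx⟩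
    simp only [A, dif_pos hex]
    have := hex.choose_spec.2
    rw [Metric.mem_ball] at this hyx
    rw [Metric.mem_closedBall]
    have h1 := dist_triangle_right y hex.choose x
    linarith
  refine (eLpNorm_mono_measure _ (Measure.restrict_mono hcov le_rfl)).trans ?_
  refine (hC' _ volume A g (C * (W + ω)) le_rfl ?_).trans (by push_cast; rw [mul_assoc])
  intro x _
  by_cases hex : ∃ y, Metric.closedBall y (2 * a) ⊆ H ∧ y ∈ Metric.ball x (a / 2)
  · simp only [A, dif_pos hex]
    exact hsingle _ hex.choose_spec.1
  · have : A x = ∅ := dif_neg hex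
    simp [this]

/-- `H` can be left at every point by `r` equal coordinate steps that end up deep inside `H`. -/
def StepProperty {n : ℕ} (H : Set (Fin n → ℝ)) (r : ℕ) (s δ : ℝ) : Prop :=
  ∀ v ∈ H, ∃ (i : Fin n) (σ : ℝ), (σ = 1 ∨ σ = -1) ∧ ∀ j ∈ Finset.Icc 1 r,
    Metric.closedBall (v + (j : ℝ) • Pi.single i (σ * s)) δ ⊆ H

/-- `H` is a union of `2 * n` pieces, one for each signed coordinate direction in which the `r`
steps reach the core. On each piece one use of the difference identity reduces to the core. -/
theorem exists_eLpNorm_le_of_stepProperty (n r : ℕ) (hr : 1 ≤ r) {p : ℝ≥0∞} (hp : p ≠ 0)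
    {a D s : ℝ} (ha : 0 < a) :
    ∃ C : ℝ≥0, ∀ {H : Set (Fin n → ℝ)} {g : (Fin n → ℝ) → ℝ} {ω W : ℝ≥0∞} (y₀ : Fin n → ℝ),
      Convex ℝ H → H ⊆ Metric.closedBall 0 D → StepProperty H r s (2 * a) → Measurable g →
      DiffBound H r g p ω → Metric.closedBall y₀ (2 * a) ⊆ H →
      eLpNorm g p (volume.restrict (Metric.closedBall y₀ a)) ≤ W →
      eLpNorm g p (volume.restrict H) ≤ C * (W + ω) := by
  obtain ⟨C₁, hC₁⟩ := exists_eLpNorm_core_le n r hr hp (D := D) ha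
  obtain ⟨C₂, hC₂⟩ := exists_eLpNorm_le_of_step r p
  obtain ⟨C₃, hC₃⟩ := exists_eLpNorm_biUnion_le (Fintype.card (Fin n × Bool)) hp
  refine ⟨C₃ * (C₂ * (C₁ + 1)), fun {H g ω W} y₀ hH hHD hst hg hd hy₀ hW => ?_⟩
  let A : Fin n × Bool → Set (Fin n → ℝ) := fun m => {v | v ∈ H ∧ ∀ j ∈ Finset.Icc 1 r,
    Metric.closedBall (v + (j : ℝ) • Pi.single m.1 ((if m.2 then 1 else -1) * s)) (2 * a) ⊆ H}
  have hcov : H ⊆ ⋃ m ∈ (Finset.univ : Finset (Fin n × Bool)), A m := by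
    intro v hv
    obtain ⟨i, σ, hσ, h⟩ := hst v hv
    simp only [Finset.mem_univ, iUnion_true, mem_iUnion]
    rcases hσ with rfl | rfl
    · exact ⟨(i, true), hv, by simpa using h⟩
    · exact ⟨(i, false), hv, by simpa using h⟩
  refine (eLpNorm_mono_measure _ (Measure.restrict_mono hcov le_rfl)).trans ?_
  refine (hC₃ _ volume A g (C₂ * (C₁ + 1) * (W + ω)) (by simp) ?_).trans
    (by push_cast; simp only [mul_assoc, le_refl])
  intro m _
  refine (hC₂ (A := A m) m.1 _ hg hd (fun x hx => ⟨hx.1, ?_⟩) (fun x hx j hj => hx.2 j hj)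
    (hC₁ y₀ hH hHD hg hd hy₀ hW)).trans ?_
  · exact hx.2 r (by simp [hr]) (Metric.mem_closedBall_self (by positivity))
  · rw [mul_assoc, add_mul, one_mul]
    gcongr
    exact le_add_self

/-! ### Norms over points and steps jointly. -/

theorem eLpNorm_prod_le_of_forall {α β : Type*} [MeasurableSpace α] [MeasurableSpace β]
    {μ : Measure α} {ν : Measure β} [SFinite μ] [SFinite ν] {F : α × β → ℝ} (hF : Measurable F)
    {p : ℝ≥0∞} (hp : p ≠ 0) {W : ℝ≥0∞}
    (h : ∀ᵐ y ∂ν, eLpNorm (fun x => F (x, y)) p μ ≤ W) :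
    eLpNorm F p (μ.prod ν) ≤ ν univ ^ (1 / p.toReal) * W := by
  rcases eq_or_ne p ∞ with rfl | hp'
  · simp only [ENNReal.toReal_top, div_zero, ENNReal.rpow_zero, one_mul,
      eLpNorm_exponent_top] at h ⊢
    refine eLpNormEssSup_le_of_ae_enorm_bound ?_
    have hm : MeasurableSet {z : α × β | ‖F z‖ₑ ≤ W} := measurableSet_le hF.enorm measurable_const
    have h2 : ∀ᵐ z ∂(ν.prod μ), ‖F z.swap‖ₑ ≤ W := by
      rw [Measure.ae_prod_iff_ae_ae (p := fun z : β × α => ‖F z.swap‖ₑ ≤ W)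
        (hm.preimage measurable_swap)]
      filter_upwards [h] with y hy
      filter_upwards [enorm_ae_le_eLpNormEssSup (fun x => F (x, y)) μ] with x hx
      exact hx.trans hy
    have h3 := (Measure.measurePreserving_swap (μ := μ) (ν := ν)).quasiMeasurePreserving.ae h2
    simpa using h3
  · have hpos : 0 < p.toReal := ENNReal.toReal_pos hp hp'
    rw [eLpNorm_eq_lintegral_rpow_enorm_toReal hp hp', one_div, ENNReal.rpow_inv_le_iff hpos,
      ENNReal.mul_rpow_of_nonneg _ _ hpos.le, ← ENNReal.rpow_mul, inv_mul_cancel₀ hpos.ne',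
      ENNReal.rpow_one, lintegral_prod_symm' _ (by fun_prop)]
    calc ∫⁻ y, ∫⁻ x, ‖F (x, y)‖ₑ ^ p.toReal ∂μ ∂ν ≤ ∫⁻ y, W ^ p.toReal ∂ν := by
          refine lintegral_mono_ae ?_
          filter_upwards [h] with y hy
          rwa [eLpNorm_eq_lintegral_rpow_enorm_toReal hp hp', one_div,
            ENNReal.rpow_inv_le_iff hpos] at hy
      _ = ν univ * W ^ p.toReal := by simp [mul_comm]

/-- Markov's inequality in `y`: if `F (x, ·)` dominates `G x` on a set of measure at least `c`, then
`c * |G x| ^ p` is at most the fibre integral. For `p = ∞` it suffices that this set is not null. -/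
theorem eLpNorm_le_eLpNorm_prod {α β : Type*} [MeasurableSpace α] [MeasurableSpace β]
    {μ : Measure α} {ν : Measure β} [SFinite μ] [SFinite ν] {G : α → ℝ} {F : α × β → ℝ}
    (hF : Measurable F) {p : ℝ≥0∞} (hp : p ≠ 0) {c : ℝ≥0∞} (hc : c ≠ 0) (hc' : c ≠ ∞)
    (h : ∀ᵐ x ∂μ, c ≤ ν {y | ‖G x‖ₑ ≤ ‖F (x, y)‖ₑ}) :
    eLpNorm G p μ ≤ (c⁻¹) ^ (1 / p.toReal) * eLpNorm F p (μ.prod ν) := by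
  rcases eq_or_ne p ∞ with rfl | hp'
  · simp only [ENNReal.toReal_top, div_zero, ENNReal.rpow_zero, one_mul, eLpNorm_exponent_top]
    refine eLpNormEssSup_le_of_ae_enorm_bound ?_
    have h2 := Measure.ae_ae_of_ae_prod (enorm_ae_le_eLpNormEssSup F (μ.prod ν))
    filter_upwards [h, h2] with x hx hx2
    by_contra hlt
    rw [not_le] at hlt
    have : ν {y | ‖G x‖ₑ ≤ ‖F (x, y)‖ₑ} = 0 := by
      refine measure_mono_null (fun y hy => ?_) hx2
      exact fun h' => absurd (hlt.trans_le (le_trans hy h')) (lt_irrefl _)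
    exact hc (le_antisymm (this ▸ hx) zero_le)
  · have hpos : 0 < p.toReal := ENNReal.toReal_pos hp hp'
    rw [eLpNorm_eq_lintegral_rpow_enorm_toReal hp hp', one_div, ENNReal.rpow_inv_le_iff hpos,
      ENNReal.mul_rpow_of_nonneg _ _ hpos.le, ← ENNReal.rpow_mul, inv_mul_cancel₀ hpos.ne',
      ENNReal.rpow_one, eLpNorm_eq_lintegral_rpow_enorm_toReal hp hp', one_div, ← ENNReal.rpow_mul,
      inv_mul_cancel₀ hpos.ne', ENNReal.rpow_one, lintegral_prod _ (by fun_prop),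
      ← ENNReal.mul_le_iff_le_inv hc hc', ← lintegral_const_mul' _ _ hc']
    refine lintegral_mono_ae ?_
    filter_upwards [h] with x hx
    calc c * ‖G x‖ₑ ^ p.toReal
        ≤ ‖G x‖ₑ ^ p.toReal * ν {y | ‖G x‖ₑ ^ p.toReal ≤ ‖F (x, y)‖ₑ ^ p.toReal} := by
          rw [mul_comm]
          gcongr
          refine hx.trans (measure_mono fun y hy => ?_)
          exact ENNReal.rpow_le_rpow hy hpos.le
      _ ≤ ∫⁻ y, ‖F (x, y)‖ₑ ^ p.toReal ∂ν :=
          mul_meas_ge_le_lintegral (by fun_prop) _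

/-! ### Representation of a function by shifted values. -/

/-- The point with coordinates `x i + k i * u i`. -/
def shiftPt {n : ℕ} (k : Fin n → ℕ) (x u : Fin n → ℝ) : Fin n → ℝ :=
  fun i => x i + (k i : ℝ) * u i

/-- The cube `[0, b]^n`. -/
abbrev cube (n : ℕ) (b : ℝ) : Set (Fin n → ℝ) := Icc 0 (fun _ => b)

theorem continuous_shiftPt {n : ℕ} (k : Fin n → ℕ) :
    Continuous (fun z : (Fin n → ℝ) × (Fin n → ℝ) => shiftPt k z.1 z.2) := by
  unfold shiftPt; fun_prop

theorem shiftPt_mem_cube {n r : ℕ} (hr : 1 ≤ r) {b : ℝ} {k : Fin n → ℕ} (hk : ∀ i, k i ≤ r)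
    {x u : Fin n → ℝ} (hx : x ∈ cube n b) (hu : u ∈ cube n (b / r)) :
    shiftPt k x u ∈ cube n (2 * b) := by
  have hr0 : (0 : ℝ) < r := by exact_mod_cast hr
  refine ⟨fun i => ?_, fun i => ?_⟩
  · exact add_nonneg (hx.1 i) (mul_nonneg (by positivity) (hu.1 i))
  · have h1 : (k i : ℝ) * u i ≤ r * (b / r) :=
      mul_le_mul (by exact_mod_cast hk i) (hu.2 i) (hu.1 i) hr0.le
    rw [mul_div_cancel₀ _ hr0.ne'] at h1
    have h2 := hx.2 i
    simp only [shiftPt] at h2 ⊢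
    linarith

/-- Coefficients `a m` and multi-indices `k m` such that `g x - ∑ m, a m * g (x + k m * u)` is
controlled by the coordinate differences of `g`. -/
structure ShiftRep (n r : ℕ) (p : ℝ≥0∞) (S : Finset (Fin n)) where
  ι : Type
  fintype : Fintype ι
  coeff : ι → ℝ
  mult : ι → Fin n → ℕ
  one_le : ∀ m, ∀ i ∈ S, 1 ≤ mult m i
  le_order : ∀ m i, mult m i ≤ r
  eq_zero : ∀ m, ∀ i ∉ S, mult m i = 0
  error_le : ∀ b : ℝ, ∃ C : ℝ≥0, ∀ {g : (Fin n → ℝ) → ℝ} {ω : ℝ≥0∞}, Measurable g →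
    DiffBound (cube n (2 * b)) r g p ω →
    eLpNorm (fun z : (Fin n → ℝ) × (Fin n → ℝ) =>
      g z.1 - ∑ m, coeff m * g (shiftPt (mult m) z.1 z.2)) p
      ((volume.restrict (cube n b)).prod (volume.restrict (cube n (b / r)))) ≤ C * ω

theorem measurable_finDiff_shiftPt {n r : ℕ} {g : (Fin n → ℝ) → ℝ} (hg : Measurable g)
    (k : Fin n → ℕ) (i : Fin n) : Measurable (fun z : (Fin n → ℝ) × (Fin n → ℝ) =>
      finDiff r (Pi.single i (z.2 i)) g (shiftPt k z.1 z.2)) := by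
  unfold finDiff
  refine Finset.measurable_fun_sum _ fun j _ => ?_
  refine (hg.comp (Continuous.measurable ?_)).const_mul _
  have h1 : Continuous (fun z : (Fin n → ℝ) × (Fin n → ℝ) =>
      (Pi.single i (z.2 i) : Fin n → ℝ)) :=
    (continuous_single i).comp (by fun_prop)
  have h2 : Continuous (fun z : (Fin n → ℝ) × (Fin n → ℝ) =>
      (j : ℝ) • (Pi.single i (z.2 i) : Fin n → ℝ)) := h1.const_smul (j : ℝ)
  exact (continuous_shiftPt k).add h2

theorem eLpNorm_finDiff_shiftPt_le {n r : ℕ} (hr : 1 ≤ r) {p : ℝ≥0∞} (hp : p ≠ 0) {b : ℝ}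
    {g : (Fin n → ℝ) → ℝ} {ω : ℝ≥0∞} (hg : Measurable g) (hd : DiffBound (cube n (2 * b)) r g p ω)
    {k : Fin n → ℕ} (hk : ∀ i, k i ≤ r) {i : Fin n} (hi : k i = 0) :
    eLpNorm (fun z : (Fin n → ℝ) × (Fin n → ℝ) =>
      finDiff r (Pi.single i (z.2 i)) g (shiftPt k z.1 z.2)) p
      ((volume.restrict (cube n b)).prod (volume.restrict (cube n (b / r))))
      ≤ (volume (cube n (b / r))) ^ (1 / p.toReal) * ω := by
  have hr0 : (0 : ℝ) < r := by exact_mod_cast hr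
  have hm := measurable_finDiff_shiftPt (r := r) hg k i
  refine (eLpNorm_prod_le_of_forall hm hp (W := ω) ?_).trans (by rw [Measure.restrict_apply_univ])
  filter_upwards [ae_restrict_mem measurableSet_Icc] with u hu
  refine le_trans ?_ (hd i (u i))
  refine eLpNorm_translate_le (fun l => (k l : ℝ) * u l) (fun x hx => And.intro ?_ ?_)
    (finDiff r (Pi.single i (u i)) g) p
  · exact shiftPt_mem_cube hr hk hx hu
  · classical
    have : x + (fun l => (k l : ℝ) * u l) + (r : ℝ) • Pi.single i (u i)
        = shiftPt (Function.update k i r) x u := by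
      ext l
      rcases eq_or_ne l i with rfl | hl
      · simp [shiftPt, hi]
      · simp [shiftPt, hl]
    rw [this]
    refine shiftPt_mem_cube hr (fun l => ?_) hx hu
    rcases eq_or_ne l i with rfl | hl
    · simp
    · simpa [hl] using hk l

/-- Induction on `S`: each `g (x + k u)` with `k i = 0` is expanded by `finDiff_eq_add` with step `u
i` in coordinate `i`. This replaces `k i` by `1, …, r` and adds a difference to the error. -/
theorem nonempty_shiftRep (n : ℕ) {r : ℕ} (hr : 1 ≤ r) {p : ℝ≥0∞} (hp : p ≠ 0)
    (S : Finset (Fin n)) : Nonempty (ShiftRep n r p S) := by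
  classical
  induction S using Finset.induction_on with
  | empty =>
    refine ⟨⟨Unit, inferInstance, fun _ => 1, fun _ _ => 0, by simp, by simp, by simp,
      fun b => ⟨0, fun {g ω} _ _ => ?_⟩⟩⟩
    have : ∀ x u : Fin n → ℝ, shiftPt (fun _ => 0) x u = x := fun x u => by ext; simp [shiftPt]
    simp [this]
  | insert i S hi ih =>
    obtain ⟨R⟩ := ih
    let := R.fintype
    refine ⟨⟨R.ι × Finset.Icc 1 r, inferInstance,
      fun m => R.coeff m.1 * (-(-1 : ℝ) ^ (m.2 : ℕ) * (r.choose m.2 : ℝ)),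
      fun m => Function.update (R.mult m.1) i m.2, ?_, ?_, ?_, fun b => ?_⟩⟩
    · intro m l hl
      rcases eq_or_ne l i with rfl | hli
      · simpa using (Finset.mem_Icc.1 m.2.2).1
      · simpa [hli] using R.one_le m.1 l (by simpa [hli] using hl)
    · intro m l
      rcases eq_or_ne l i with rfl | hli
      · simpa using (Finset.mem_Icc.1 m.2.2).2
      · simpa [hli] using R.le_order m.1 l
    · intro m l hl
      rw [Finset.mem_insert, not_or] at hl
      simpa [hl.1] using R.eq_zero m.1 l hl.2
    · obtain ⟨C₁, hC₁⟩ := R.error_le b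
      obtain ⟨C₂, hC₂⟩ := exists_eLpNorm_sum_le (Finset.univ : Finset (Option R.ι))
        (fun m => m.elim 1 (fun m => R.coeff m * (-1) ^ r)) p
      have hvol : volume (cube n (b / r)) ^ (1 / p.toReal) ≠ ∞ :=
        (ENNReal.rpow_lt_top_of_nonneg (by positivity) isCompact_Icc.measure_lt_top.ne).ne
      refine ⟨C₂ * (C₁ + (volume (cube n (b / r)) ^ (1 / p.toReal)).toNNReal),
        fun {g ω} hg hd => ?_⟩
      have hi0 : ∀ m, R.mult m i = 0 := fun m => R.eq_zero m i hi
      have hm : ∀ m, Measurable (fun z : (Fin n → ℝ) × (Fin n → ℝ) =>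
          g (shiftPt (R.mult m) z.1 z.2)) := fun m => hg.comp (continuous_shiftPt _).measurable
      have hmd := fun m => measurable_finDiff_shiftPt (r := r) hg (R.mult m) i
      have h := hC₂ ((volume.restrict (cube n b)).prod (volume.restrict (cube n (b / r))))
        (fun m z => m.elim (g z.1 - ∑ m, R.coeff m * g (shiftPt (R.mult m) z.1 z.2))
          (fun m => finDiff r (Pi.single i (z.2 i)) g (shiftPt (R.mult m) z.1 z.2)))
        ((C₁ + volume (cube n (b / r)) ^ (1 / p.toReal)) * ω) ?_ ?_
      · refine le_trans (le_of_eq ?_) (h.trans (le_of_eq ?_))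
        · congr 1
          ext z
          rw [Fintype.sum_option, Fintype.sum_prod_type]
          simp only [Option.elim, one_mul]
          have key : ∀ m, g (shiftPt (R.mult m) z.1 z.2) - ∑ j : Finset.Icc 1 r,
              (-(-1 : ℝ) ^ (j : ℕ) * (r.choose j : ℝ)) *
                g (shiftPt (Function.update (R.mult m) i j) z.1 z.2)
              = (-1) ^ r * finDiff r (Pi.single i (z.2 i)) g (shiftPt (R.mult m) z.1 z.2) := by
            intro m
            rw [finDiff_eq_add r (Pi.single i (z.2 i)) g (shiftPt (R.mult m) z.1 z.2),
              ← Finset.sum_coe_sort (Finset.Icc 1 r), sub_eq_iff_eq_add]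
            congr 1
            refine Finset.sum_congr rfl fun j _ => ?_
            congr 2
            ext l
            rcases eq_or_ne l i with rfl | hl
            · simp [shiftPt, hi0]
            · simp [shiftPt, hl]
          rw [← sub_eq_zero]
          have h2 : ∀ m, R.coeff m * (-1) ^ r *
              finDiff r (Pi.single i (z.2 i)) g (shiftPt (R.mult m) z.1 z.2)
              = R.coeff m * g (shiftPt (R.mult m) z.1 z.2) - ∑ j : Finset.Icc 1 r,
                R.coeff m * (-(-1 : ℝ) ^ (j : ℕ) * (r.choose j : ℝ)) *
                g (shiftPt (Function.update (R.mult m) i j) z.1 z.2) := by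
            intro m
            rw [mul_assoc, ← key m, mul_sub, Finset.mul_sum]
            simp only [mul_assoc]
          simp only [h2, Finset.sum_sub_distrib]
          ring
        · rw [ENNReal.coe_mul, ENNReal.coe_add, ENNReal.coe_toNNReal hvol, mul_assoc]
      · rintro (_ | m) _
        · refine Measurable.aestronglyMeasurable ?_
          exact (hg.comp measurable_fst).sub
            (Finset.measurable_fun_sum _ fun m _ => (hm m).const_mul _)
        · exact (hmd m).aestronglyMeasurable
      · rintro (_ | m) _
        · exact (hC₁ hg hd).trans (mul_le_mul_left le_self_add _)
        · exact (eLpNorm_finDiff_shiftPt_le hr hp hg hd (R.le_order m) (hi0 m)).trans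
            (mul_le_mul_left le_add_self _)

/-- The Jacobian of `u ↦ x + k u` is `∏ k i ≥ 1`. This is the reason for requiring every multiplier
to be at least `1`: small or null sets of values pull back to small or null sets of steps. -/
theorem volume_shiftPt_preimage_le {n : ℕ} {k : Fin n → ℕ} (hk : ∀ i, 1 ≤ k i) (x : Fin n → ℝ)
    (B : Set (Fin n → ℝ)) : volume {u | shiftPt k x u ∈ B} ≤ volume B := by
  have h1 : {u | shiftPt k x u ∈ B} =
      Matrix.toLin' (Matrix.diagonal fun i => (k i : ℝ)) ⁻¹' ((fun y => x + y) ⁻¹' B) := by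
    ext u
    simp only [mem_ofPred_eq, mem_preimage, Matrix.toLin'_apply]
    have : shiftPt k x u = x + (Matrix.diagonal fun i => (k i : ℝ)).mulVec u := by
      ext i; simp [shiftPt, Matrix.mulVec_diagonal]
    rw [this]
  have hdet : LinearMap.det (Matrix.toLin' (Matrix.diagonal fun i => (k i : ℝ)))
      = ∏ i, (k i : ℝ) := by
    rw [LinearMap.det_toLin', Matrix.det_diagonal]
  have hprod : (1 : ℝ) ≤ ∏ i, (k i : ℝ) := by
    have : 0 < ∏ i, k i := Finset.prod_pos fun i _ => hk i
    rw [← Nat.succ_le_iff] at this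
    exact_mod_cast this
  rw [h1, Measure.addHaar_preimage_linearMap _ (by rw [hdet]; positivity), measure_preimage_add,
    hdet]
  refine mul_le_of_le_one_left' ?_
  rw [ENNReal.ofReal_le_one, abs_of_nonneg (by positivity)]
  exact inv_le_one_of_one_le₀ hprod

namespace ShiftRep

variable {n r : ℕ} {p : ℝ≥0∞}

/-- The remainder in the representation. -/
def err {S : Finset (Fin n)} (R : ShiftRep n r p S) (g : (Fin n → ℝ) → ℝ)
    (z : (Fin n → ℝ) × (Fin n → ℝ)) : ℝ :=
  letI := R.fintype
  g z.1 - ∑ m, R.coeff m * g (shiftPt (R.mult m) z.1 z.2)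

theorem measurable_err {S : Finset (Fin n)} (R : ShiftRep n r p S) {g : (Fin n → ℝ) → ℝ}
    (hg : Measurable g) : Measurable (R.err g) := by
  let := R.fintype
  exact (hg.comp measurable_fst).sub
    (Finset.measurable_fun_sum _ fun m _ => (hg.comp (continuous_shiftPt _).measurable).const_mul _)

/-- The sum of the absolute values of the coefficients. -/
def coeffSum {S : Finset (Fin n)} (R : ShiftRep n r p S) : ℝ :=
  letI := R.fintype
  ∑ m, |R.coeff m|

theorem coeffSum_nonneg {S : Finset (Fin n)} (R : ShiftRep n r p S) : 0 ≤ R.coeffSum :=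
  let := R.fintype
  Finset.sum_nonneg fun _ _ => abs_nonneg _

theorem abs_sum_le {S : Finset (Fin n)} (R : ShiftRep n r p S) {g : (Fin n → ℝ) → ℝ} {θ : ℝ}
    {x u : Fin n → ℝ} (h : ∀ m, |g (shiftPt (R.mult m) x u)| ≤ θ) :
    letI := R.fintype
    |∑ m, R.coeff m * g (shiftPt (R.mult m) x u)| ≤ R.coeffSum * θ := by
  let := R.fintype
  refine (Finset.abs_sum_le_sum_abs _ _).trans ?_
  rw [coeffSum, Finset.sum_mul]
  refine Finset.sum_le_sum fun m _ => ?_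
  rw [abs_mul]
  exact mul_le_mul_of_nonneg_left (h m) (abs_nonneg _)

/-- If `|g|` exceeds `θ` only on a small set, then for at least half of the steps the value of `g`
is controlled by `θ` and the remainder. -/
theorem half_le_volume (R : ShiftRep n r p Finset.univ) (hr : 1 ≤ r) {b θ : ℝ}
    {g : (Fin n → ℝ) → ℝ}
    (hsmall : letI := R.fintype; volume {y | y ∈ cube n (2 * b) ∧ θ < |g y|} ≤
      volume (cube n (b / r)) / (2 * (Fintype.card R.ι + 1)))
    {x : Fin n → ℝ} (hx : x ∈ cube n b) :
    volume (cube n (b / r)) / 2 ≤ volume.restrict (cube n (b / r))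
      {u | |g x| ≤ R.coeffSum * θ + |R.err g (x, u)|} := by
  let := R.fintype
  have hfin : volume (cube n (b / r)) ≠ ∞ := isCompact_Icc.measure_lt_top.ne
  set U := cube n (b / r) with hU
  set B := {y | y ∈ cube n (2 * b) ∧ θ < |g y|} with hB
  set bad : Set (Fin n → ℝ) := ⋃ m : R.ι, {u | shiftPt (R.mult m) x u ∈ B} with hbad
  -- A union bound over the terms of the representation. The `+ 1` in the threshold keeps the
  -- denominator nonzero without counting the terms.
  have hbadv : volume bad ≤ volume U / 2 := by
    calc volume bad ≤ ∑ m : R.ι, volume {u | shiftPt (R.mult m) x u ∈ B} :=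
          measure_iUnion_fintype_le _ _
      _ ≤ ∑ m : R.ι, volume B := Finset.sum_le_sum fun m _ =>
          volume_shiftPt_preimage_le (fun i => R.one_le m i (Finset.mem_univ i)) x B
      _ = Fintype.card R.ι * volume B := by simp
      _ ≤ (Fintype.card R.ι + 1) * (volume U / (2 * (Fintype.card R.ι + 1))) := by
          gcongr
          exact le_self_add
      _ = volume U / 2 := by
          rw [div_eq_mul_inv, div_eq_mul_inv, ENNReal.mul_inv (by simp) (by simp)]
          have h1 : ((Fintype.card R.ι : ℝ≥0∞) + 1) * ((Fintype.card R.ι : ℝ≥0∞) + 1)⁻¹ = 1 :=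
            ENNReal.mul_inv_cancel (by simp) (by simp)
          rw [mul_left_comm, mul_left_comm _ (2 : ℝ≥0∞)⁻¹, h1, mul_one]
  have hsub : U \ bad ⊆ {u | |g x| ≤ R.coeffSum * θ + |R.err g (x, u)|} ∩ U := by
    rintro u ⟨hu, hub⟩
    refine ⟨?_, hu⟩
    have h1 : ∀ m, |g (shiftPt (R.mult m) x u)| ≤ θ := by
      intro m
      by_contra hlt
      rw [not_le] at hlt
      exact hub (mem_iUnion.2 ⟨m, shiftPt_mem_cube hr (R.le_order m) hx hu, hlt⟩)
    have h2 := R.abs_sum_le h1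
    have h3 : g x = (∑ m, R.coeff m * g (shiftPt (R.mult m) x u)) + R.err g (x, u) := by
      simp [err]
    rw [mem_ofPred_eq]
    conv_lhs => rw [h3]
    exact (abs_add_le _ _).trans (by linarith)
  have h1 : volume U - volume bad ≤ volume (U \ bad) := le_measure_sdiff
  have h2 : volume U / 2 ≤ volume U - volume bad := by
    refine ENNReal.le_sub_of_add_le_left
      (ne_top_of_le_ne_top (ENNReal.div_ne_top hfin (by simp)) hbadv) ?_
    calc volume bad + volume U / 2 ≤ volume U / 2 + volume U / 2 := by gcongr
      _ = volume U := ENNReal.add_halves _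
  refine h2.trans (h1.trans ?_)
  rw [Measure.restrict_apply' measurableSet_Icc]
  exact measure_mono hsub

end ShiftRep

theorem volume_cube_ne_zero (n : ℕ) {b : ℝ} (hb : 0 < b) : volume (cube n b) ≠ 0 := by
  rw [cube, Real.volume_Icc_pi]
  simp [hb]

/-- Smallness in measure improves to a norm bound on a smaller cube: the excess of `|g|` over a
multiple of `θ` is at most the remainder for at least half of the steps, and the remainder is of
order `ω`. The threshold `c` does not depend on `θ`; this takes the place of uniform integrability.
-/
theorem exists_eLpNorm_le_of_volume_le (n : ℕ) {r : ℕ} (hr : 1 ≤ r) {p : ℝ≥0∞} (hp : p ≠ 0) {b : ℝ}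
    (hb : 0 < b) :
    ∃ (c : ℝ≥0∞) (C : ℝ≥0), c ≠ 0 ∧ ∀ {g : (Fin n → ℝ) → ℝ} {ω : ℝ≥0∞} {θ : ℝ≥0}, Measurable g →
      DiffBound (cube n (2 * b)) r g p ω →
      volume {y | y ∈ cube n (2 * b) ∧ (θ : ℝ) < |g y|} ≤ c →
      eLpNorm g p (volume.restrict (cube n b)) ≤ C * (θ + ω) := by
  obtain ⟨R⟩ := nonempty_shiftRep n hr hp Finset.univ
  let := R.fintype
  have hr0 : (0 : ℝ) < r := by exact_mod_cast hr
  have hU0 := volume_cube_ne_zero n (div_pos hb hr0)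
  have hUfin : volume (cube n (b / r)) ≠ ∞ := isCompact_Icc.measure_lt_top.ne
  obtain ⟨C₁, hC₁⟩ := R.error_le b
  obtain ⟨C₂, hC₂⟩ := exists_eLpNorm_sum_le (Finset.univ : Finset Bool) (fun _ => 1) p
  set κ : ℝ≥0∞ := (volume (cube n (b / r)) / 2)⁻¹ ^ (1 / p.toReal) with hκ
  have hκfin : κ ≠ ∞ := (ENNReal.rpow_lt_top_of_nonneg (by positivity)
    (by simp [ENNReal.div_eq_zero_iff, hU0])).ne
  set τ : ℝ≥0∞ := volume (cube n b) ^ (1 / p.toReal) with hτ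
  have hτfin : τ ≠ ∞ :=
    (ENNReal.rpow_lt_top_of_nonneg (by positivity) isCompact_Icc.measure_lt_top.ne).ne
  refine ⟨volume (cube n (b / r)) / (2 * (Fintype.card R.ι + 1)),
    C₂ * (κ.toNNReal * C₁ + R.coeffSum.toNNReal * τ.toNNReal), ?_,
    fun {g ω θ} hg hd hsmall => ?_⟩
  · rw [Ne, ENNReal.div_eq_zero_iff, not_or]
    exact ⟨hU0, ENNReal.mul_ne_top (by simp) (by simp)⟩
  set A : ℝ := R.coeffSum * θ with hA
  have hA0 : 0 ≤ A := mul_nonneg R.coeffSum_nonneg θ.2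
  have hG : eLpNorm (fun x => max (|g x| - A) 0) p (volume.restrict (cube n b)) ≤ κ * (C₁ * ω) := by
    refine (eLpNorm_le_eLpNorm_prod (ν := volume.restrict (cube n (b / r)))
      (R.measurable_err hg) hp (c := volume (cube n (b / r)) / 2)
      (by simp [ENNReal.div_eq_zero_iff, hU0]) (ENNReal.div_ne_top hUfin (by simp)) ?_).trans ?_
    · filter_upwards [ae_restrict_mem measurableSet_Icc] with x hx
      refine (R.half_le_volume hr hsmall hx).trans (measure_mono fun u hu => ?_)
      rw [mem_ofPred_eq] at hu ⊢
      rw [enorm_le_iff_norm_le, Real.norm_of_nonneg (le_max_right _ _), Real.norm_eq_abs]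
      exact max_le (by linarith) (abs_nonneg _)
    · exact mul_le_mul_right (hC₁ hg hd) _
  have hsum := hC₂ (volume.restrict (cube n b)) (fun m x => if m then max (|g x| - A) 0 else A)
    ((κ * C₁ + R.coeffSum.toNNReal * τ) * (θ + ω)) ?_ ?_
  · refine (eLpNorm_mono_real fun x => ?_).trans (hsum.trans (le_of_eq ?_))
    · simp only [Fintype.sum_bool, one_mul, if_true, Bool.false_eq_true, if_false, Real.norm_eq_abs]
      have := le_max_left (|g x| - A) 0
      linarith
    · push_cast
      rw [ENNReal.coe_toNNReal hκfin, ENNReal.coe_toNNReal hτfin, mul_assoc]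
  · intro m _
    refine Measurable.aestronglyMeasurable ?_
    cases m
    · simp
    · simp only [if_true]; fun_prop
  · intro m _
    cases m
    · simp only [Bool.false_eq_true, if_false]
      rw [eLpNorm_const _ hp, Measure.restrict_apply_univ, ← hτ, Real.enorm_of_nonneg hA0, hA,
        ENNReal.ofReal_mul R.coeffSum_nonneg, ENNReal.ofReal_coe_nnreal, mul_right_comm]
      · exact mul_le_mul' le_add_self le_self_add
      · rw [Ne, Measure.restrict_eq_zero]
        exact volume_cube_ne_zero n hb
    · simp only [if_true]
      refine hG.trans ?_
      rw [← mul_assoc]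
      exact mul_le_mul' le_self_add le_add_self

/-! ### Continuous functions with vanishing differences are polynomials. -/

/-- The top coefficient of the recurrence is `1`, so each term is determined by the preceding `r`.
-/
theorem eq_zero_of_alternating_sum_eq_zero {r M : ℕ} {c : ℕ → ℝ}
    (h : ∀ l, l + r ≤ M →
      ∑ j ∈ Finset.range (r + 1), (-1 : ℝ) ^ (r + j) * (r.choose j : ℝ) * c (l + j) = 0)
    (h0 : ∀ l < r, c l = 0) : ∀ l ≤ M, c l = 0 := by
  intro l
  induction l using Nat.strong_induction_on with
  | _ l ih =>
    intro hl
    rcases lt_or_ge l r with hlr | hlr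
    · exact h0 l hlr
    · have h1 := h (l - r) (by omega)
      rw [Finset.sum_range_succ, Finset.sum_eq_zero] at h1
      · rw [Nat.sub_add_cancel hlr] at h1
        have h2 : (-1 : ℝ) ^ (r + r) = 1 := by rw [← two_mul, pow_mul]; simp
        simpa [h2] using h1
      · intro j hj
        rw [Finset.mem_range] at hj
        rw [ih (l - r + j) (by omega) (by omega), mul_zero]

/-- On the lattice of mesh `b / (r * m)` the recurrence makes `φ` agree with a polynomial of degree
`< r`, which then vanishes at the `r` nodes `b * k / r`. Taking `m ≥ 2` keeps the step strictly
below `b / r`. -/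
theorem lattice_eq_zero {r : ℕ} (hr : 1 ≤ r) {b : ℝ} (hb : 0 < b) {φ : ℝ → ℝ}
    (h : ∀ x u : ℝ, 0 ≤ x → 0 < u → r * u < b → x + r * u ≤ b → finDiff r u φ x = 0)
    (h0 : ∀ k < r, φ (b * k / r) = 0) {m : ℕ} (hm : 2 ≤ m) :
    ∀ l ≤ r * m, φ (l * (b / (r * m))) = 0 := by
  have hr0 : (0 : ℝ) < r := by exact_mod_cast hr
  have hm1 : (1 : ℝ) < m := by exact_mod_cast hm
  have hm0 : (0 : ℝ) < m := by linarith
  set u : ℝ := b / (r * m) with hu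
  have hu0 : 0 < u := by positivity
  have hmu : r * (m * u) = b := by rw [hu]; field_simp
  have hinj : ∀ s : Set ℕ, InjOn (fun l : ℕ => (l : ℝ) * u) s := fun s x _ y _ hxy => by
    simpa [hu0.ne'] using hxy
  set q := Lagrange.interpolate (Finset.range r) (fun l : ℕ => (l : ℝ) * u)
    (fun l : ℕ => φ (l * u)) with hq
  have hqdeg : q.degree < (r : WithBot ℕ) := by
    have := Lagrange.degree_interpolate_lt (s := Finset.range r)
      (fun l : ℕ => φ (l * u)) (hinj _)
    rwa [Finset.card_range] at this
  have hc : ∀ l ≤ r * m, φ (l * u) - q.eval ((l : ℝ) * u) = 0 := by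
    refine eq_zero_of_alternating_sum_eq_zero (r := r) (c := fun l : ℕ => φ (l * u) -
      q.eval ((l : ℝ) * u)) (fun l hl => ?_) (fun l hl => ?_)
    · have h1 : finDiff r u φ (l * u) = 0 := by
        refine h _ _ (by positivity) hu0 ?_ ?_
        · nlinarith
        · have : ((l : ℝ) + r) ≤ r * m := by exact_mod_cast hl
          nlinarith
      have h2 := finDiff_polynomial hqdeg ((l : ℝ) * u) u
      rw [← sub_eq_zero.2 (h1.trans h2.symm), ← finDiff_sub, finDiff]
      refine Finset.sum_congr rfl fun j _ => ?_
      have : ((l + j : ℕ) : ℝ) * u = (l : ℝ) * u + (j : ℝ) • u := by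
        push_cast; rw [smul_eq_mul]; ring
      simp only [this]
    · have := Lagrange.eval_interpolate_at_node (s := Finset.range r)
        (fun l : ℕ => φ (l * u)) (hinj _) (Finset.mem_range.2 hl)
      simp only [← hq] at this
      rw [this, sub_self]
  -- The coarse node `b * k / r` is the lattice point with index `k * m`.
  have hq0 : q = 0 := by
    refine Polynomial.eq_zero_of_degree_lt_of_eval_index_eq_zero (s := Finset.range r)
      (v := fun k : ℕ => ((k * m : ℕ) : ℝ) * u) ?_ (by simpa using hqdeg) ?_
    · intro x _ y _ hxy
      have : m ≠ 0 := by omega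
      simpa [hu0.ne', this] using hxy
    · intro k hk
      rw [Finset.mem_range] at hk
      have h1 := hc (k * m) (Nat.mul_le_mul_right m hk.le)
      have h2 : ((k * m : ℕ) : ℝ) * u = b * k / r := by
        push_cast; rw [← hmu]; field_simp
      rw [h2] at h1 ⊢
      rw [h0 k hk, zero_sub, neg_eq_zero] at h1
      exact h1
  intro l hl
  have := hc l hl
  rwa [hq0, Polynomial.eval_zero, sub_zero] at this

/-- Each point of the interval is a limit of lattice points as `m → ∞`, and `φ` is continuous. -/
theorem eqOn_zero_of_finDiff_eq_zero {r : ℕ} (hr : 1 ≤ r) {b : ℝ} (hb : 0 < b) {φ : ℝ → ℝ}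
    (hφ : ContinuousOn φ (Icc 0 b))
    (h : ∀ x u : ℝ, 0 ≤ x → 0 < u → r * u < b → x + r * u ≤ b → finDiff r u φ x = 0)
    (h0 : ∀ k < r, φ (b * k / r) = 0) {t : ℝ} (ht : t ∈ Icc 0 b) : φ t = 0 := by
  have hr0 : (0 : ℝ) < r := by exact_mod_cast hr
  have ha : 0 ≤ t * r / b := div_nonneg (mul_nonneg ht.1 hr0.le) hb.le
  have hlim : Filter.Tendsto (fun m : ℕ => (⌊t * r / b * m⌋₊ : ℝ) * (b / (r * m)))
      Filter.atTop (nhds t) := by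
    have h1 := (tendsto_nat_floor_mul_div_atTop ha).comp tendsto_natCast_atTop_atTop
    have h2 := h1.mul_const (b / r)
    have h3 : t * r / b * (b / r) = t := by field_simp
    rw [h3] at h2
    refine h2.congr fun m => ?_
    simp only [Function.comp]
    rw [div_mul_div_comm, mul_div_assoc, mul_comm (m : ℝ)]
  have hle : ∀ m : ℕ, ⌊t * r / b * m⌋₊ ≤ r * m := by
    intro m
    refine Nat.floor_le_of_le ?_
    push_cast
    gcongr
    rw [div_le_iff₀ hb, mul_comm]
    exact mul_le_mul_of_nonneg_left ht.2 hr0.le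
  have hmem : ∀ᶠ m : ℕ in Filter.atTop,
      (⌊t * r / b * m⌋₊ : ℝ) * (b / (r * m)) ∈ Icc 0 b := by
    filter_upwards [Filter.eventually_ge_atTop 2] with m hm
    have hm0 : (0 : ℝ) < m := by exact_mod_cast (by omega : 0 < m)
    refine ⟨by positivity, ?_⟩
    rw [← mul_div_assoc, div_le_iff₀ (by positivity), mul_comm]
    have : (⌊t * r / b * m⌋₊ : ℝ) ≤ r * m := by exact_mod_cast hle m
    gcongr
  have h2 := (hφ t ht).tendsto.comp (tendsto_nhdsWithin_iff.2 ⟨hlim, hmem⟩)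
  refine tendsto_nhds_unique h2 (tendsto_const_nhds.congr' ?_)
  filter_upwards [Filter.eventually_ge_atTop 2] with m hm
  exact (lattice_eq_zero hr hb h h0 hm _ (hle m)).symm

theorem eq_sum_basis_of_finDiff_eq_zero {r : ℕ} (hr : 1 ≤ r) {b : ℝ} (hb : 0 < b) {φ : ℝ → ℝ}
    (hφ : ContinuousOn φ (Icc 0 b))
    (h : ∀ x u : ℝ, 0 ≤ x → 0 < u → r * u < b → x + r * u ≤ b → finDiff r u φ x = 0)
    {t : ℝ} (ht : t ∈ Icc 0 b) :
    φ t = ∑ k ∈ Finset.range r, φ (b * k / r) *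
      (Lagrange.basis (Finset.range r) (fun k : ℕ => b * k / r) k).eval t := by
  have hr0 : (0 : ℝ) < r := by exact_mod_cast hr
  have hinj : InjOn (fun k : ℕ => b * k / r) (Finset.range r : Finset ℕ) := by
    intro x _ y _ hxy
    field_simp at hxy
    exact_mod_cast hxy
  set q := Lagrange.interpolate (Finset.range r) (fun k : ℕ => b * k / r)
    (fun k : ℕ => φ (b * k / r)) with hq
  have hqdeg : q.degree < (r : WithBot ℕ) := by
    have := Lagrange.degree_interpolate_lt (s := Finset.range r)
      (fun k : ℕ => φ (b * k / r)) hinj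
    rwa [Finset.card_range] at this
  have h1 := eqOn_zero_of_finDiff_eq_zero hr hb (φ := fun t => φ t - q.eval t)
    (hφ.sub q.continuous.continuousOn) (fun x u hx hu hru hxu => by
      rw [finDiff_sub, h x u hx hu hru hxu, finDiff_polynomial hqdeg, sub_zero])
    (fun k hk => by
      have := Lagrange.eval_interpolate_at_node (s := Finset.range r)
        (fun k : ℕ => φ (b * k / r)) hinj (Finset.mem_range.2 hk)
      simp only [← hq] at this
      rw [this, sub_self]) ht
  rw [sub_eq_zero.1 h1, hq, Lagrange.interpolate_apply, Polynomial.eval_finsetSum]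
  simp

theorem eval_aeval_X {n : ℕ} (y : Fin n → ℝ) (i : Fin n) (ℓ : Polynomial ℝ) :
    MvPolynomial.eval y (Polynomial.aeval (MvPolynomial.X i : MvPolynomial (Fin n) ℝ) ℓ)
      = ℓ.eval (y i) := by
  rw [Polynomial.aeval_def, Polynomial.hom_eval₂]
  have : (MvPolynomial.eval y).comp (algebraMap ℝ (MvPolynomial (Fin n) ℝ)) = RingHom.id ℝ := by
    ext; simp
  rw [this, MvPolynomial.eval_X]
  rfl

/-- In each single variable `F` equals its Lagrange interpolant at the nodes `b * k / r`. Expanding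
one coordinate at a time yields a tensor-product interpolation formula. -/
theorem exists_coordPoly_eqOn {n r : ℕ} (hr : 1 ≤ r) {b : ℝ} (hb : 0 < b) {F : (Fin n → ℝ) → ℝ}
    (hF : ContinuousOn F (cube n b))
    (h : ∀ (i : Fin n) (u : ℝ) (x : Fin n → ℝ), 0 < u → r * u < b → x ∈ cube n b →
      x + (r : ℝ) • Pi.single i u ∈ cube n b → finDiff r (Pi.single i u) F x = 0) :
    ∃ P ∈ coordPoly n r, ∀ x ∈ cube n b, F x = MvPolynomial.eval x P := by
  classical
  have hr0 : (0 : ℝ) < r := by exact_mod_cast hr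
  set ν : ℕ → ℝ := fun k => b * k / r with hν
  have hinj : InjOn ν (Finset.range r : Finset ℕ) := by
    intro x _ y _ hxy
    simp only [hν] at hxy
    field_simp at hxy
    exact_mod_cast hxy
  set ℓ : ℕ → Polynomial ℝ := fun k => Lagrange.basis (Finset.range r) ν k with hℓ
  have hℓdeg : ∀ k ∈ Finset.range r, (ℓ k).degree < (r : WithBot ℕ) := by
    intro k hk
    rw [hℓ]
    simp only
    rw [Lagrange.degree_basis hinj hk, Finset.card_range]
    exact_mod_cast Nat.sub_lt hr one_pos
  have hνmem : ∀ k ∈ Finset.range r, ν k ∈ Icc 0 b := by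
    intro k hk
    refine ⟨by positivity, ?_⟩
    rw [div_le_iff₀ hr0]
    have : (k : ℝ) ≤ r := by exact_mod_cast (Finset.mem_range.1 hk).le
    gcongr
  have hupd : ∀ x ∈ cube n b, ∀ i, ∀ t ∈ Icc 0 b, Function.update x i t ∈ cube n b := by
    intro x hx i t ht
    refine ⟨fun l => ?_, fun l => ?_⟩
    · rcases eq_or_ne l i with rfl | hl
      · simpa using ht.1
      · simpa [hl] using hx.1 l
    · rcases eq_or_ne l i with rfl | hl
      · simpa using ht.2
      · simpa [hl] using hx.2 l
  have hL : ∀ i, ∀ x ∈ cube n b, F x = ∑ k ∈ Finset.range r,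
      F (Function.update x i (ν k)) * (ℓ k).eval (x i) := by
    intro i x hx
    have h1 := eq_sum_basis_of_finDiff_eq_zero hr hb (φ := fun t => F (Function.update x i t))
      ?_ ?_ (t := x i) ⟨hx.1 i, hx.2 i⟩
    · simpa using h1
    · refine hF.comp (Continuous.continuousOn (by fun_prop)) fun t ht => hupd x hx i t ht
    · intro t u ht hu hru htu
      have hs : ∀ c : ℝ, Function.update x i t + c • Pi.single i u
          = Function.update x i (t + c * u) := by
        intro c
        ext l
        rcases eq_or_ne l i with rfl | hl
        · simp
        · simp [hl]
      have h2 := h i u (Function.update x i t) hu hru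
        (hupd x hx i t ⟨ht, by nlinarith⟩) (by
          rw [hs]; exact hupd x hx i _ ⟨by positivity, htu⟩)
      rw [← h2, finDiff, finDiff]
      simp only [hs, smul_eq_mul]
  -- Independence of the variables outside `S` is carried along so that, in the new variable `i`,
  -- the coefficients `P k` are constant and the degree is that of the Lagrange basis.
  suffices key : ∀ S : Finset (Fin n), ∀ y ∈ cube n b, ∃ P ∈ coordPoly n r,
      (∀ i ∉ S, ∀ (z : Fin n → ℝ) (t : ℝ),
        MvPolynomial.eval (z + Pi.single i t) P = MvPolynomial.eval z P) ∧
      ∀ x ∈ cube n b, F (S.piecewise x y) = MvPolynomial.eval x P by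
    obtain ⟨P, hP, -, hPF⟩ := key Finset.univ 0 ⟨le_rfl, fun _ => hb.le⟩
    exact ⟨P, hP, by simpa using hPF⟩
  intro S
  induction S using Finset.induction_on with
  | empty =>
    intro y hy
    refine ⟨MvPolynomial.C (F y), fun z i => ⟨Polynomial.C (F y), ?_, by simp⟩, by simp, by simp⟩
    exact Polynomial.degree_C_le.trans_lt (by exact_mod_cast hr)
  | insert i S hi ih =>
    intro y hy
    have ih' : ∀ k, ∃ P : MvPolynomial (Fin n) ℝ, k ∈ Finset.range r → P ∈ coordPoly n r ∧
        (∀ i ∉ S, ∀ (z : Fin n → ℝ) (t : ℝ),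
          MvPolynomial.eval (z + Pi.single i t) P = MvPolynomial.eval z P) ∧
        ∀ x ∈ cube n b, F (S.piecewise x (Function.update y i (ν k))) = MvPolynomial.eval x P := by
      intro k
      by_cases hk : k ∈ Finset.range r
      · obtain ⟨P, h1, h2, h3⟩ := ih (Function.update y i (ν k)) (hupd y hy i _ (hνmem k hk))
        exact ⟨P, fun _ => ⟨h1, h2, h3⟩⟩
      · exact ⟨0, fun h => absurd h hk⟩
    choose P hP using ih'
    have heval : ∀ z, MvPolynomial.eval z (∑ k ∈ Finset.range r, P k *
        Polynomial.aeval (MvPolynomial.X i : MvPolynomial (Fin n) ℝ) (ℓ k))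
        = ∑ k ∈ Finset.range r, MvPolynomial.eval z (P k) * (ℓ k).eval (z i) := by
      intro z
      rw [map_sum]
      simp only [map_mul, eval_aeval_X]
    refine ⟨∑ k ∈ Finset.range r, P k *
      Polynomial.aeval (MvPolynomial.X i : MvPolynomial (Fin n) ℝ) (ℓ k), ?_, ?_, ?_⟩
    · intro z l
      rcases eq_or_ne l i with rfl | hl
      · refine ⟨∑ k ∈ Finset.range r, MvPolynomial.eval z (P k) • Polynomial.taylor (z l) (ℓ k),
          ?_, fun t => ?_⟩
        · rw [← Polynomial.mem_degreeLT]
          refine Submodule.sum_mem _ fun k hk => Submodule.smul_mem _ _ ?_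
          rw [Polynomial.mem_degreeLT, Polynomial.degree_taylor]
          exact hℓdeg k hk
        · rw [heval, Polynomial.eval_finsetSum]
          refine Finset.sum_congr rfl fun k hk => ?_
          rw [(hP k hk).2.1 l hi, Polynomial.eval_smul, Polynomial.taylor_eval]
          simp [add_comm]
      · have hex : ∀ k, ∃ q : Polynomial ℝ, k ∈ Finset.range r → q.degree < (r : WithBot ℕ) ∧
            ∀ t : ℝ, MvPolynomial.eval (z + Pi.single l t) (P k) = q.eval t := by
          intro k
          by_cases hk : k ∈ Finset.range r
          · obtain ⟨q, hq⟩ := (hP k hk).1 z l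
            exact ⟨q, fun _ => hq⟩
          · exact ⟨0, fun h => absurd h hk⟩
        choose q hq using hex
        refine ⟨∑ k ∈ Finset.range r, (ℓ k).eval (z i) • q k, ?_, fun t => ?_⟩
        · rw [← Polynomial.mem_degreeLT]
          refine Submodule.sum_mem _ fun k hk => Submodule.smul_mem _ _ ?_
          rw [Polynomial.mem_degreeLT]
          exact (hq k hk).1
        · rw [heval, Polynomial.eval_finsetSum]
          refine Finset.sum_congr rfl fun k hk => ?_
          rw [(hq k hk).2, Polynomial.eval_smul]
          simp [hl.symm, mul_comm]
    · intro l hl z t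
      rw [Finset.mem_insert, not_or] at hl
      rw [heval, heval]
      refine Finset.sum_congr rfl fun k hk => ?_
      rw [(hP k hk).2.1 l hl.2]
      simp [Ne.symm hl.1]
    · intro x hx
      have hw : (insert i S).piecewise x y ∈ cube n b := by
        refine ⟨fun l => ?_, fun l => ?_⟩
        · by_cases hl : l ∈ insert i S
          · simpa only [Finset.piecewise_eq_of_mem _ _ _ hl] using hx.1 l
          · simpa only [Finset.piecewise_eq_of_notMem _ _ _ hl] using hy.1 l
        · by_cases hl : l ∈ insert i S
          · simpa only [Finset.piecewise_eq_of_mem _ _ _ hl] using hx.2 l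
          · simpa only [Finset.piecewise_eq_of_notMem _ _ _ hl] using hy.2 l
      rw [hL i _ hw, heval]
      refine Finset.sum_congr rfl fun k hk => ?_
      rw [← (hP k hk).2.2 x hx]
      congr 2
      · ext l
        rcases eq_or_ne l i with rfl | hl
        · simp [hi]
        · by_cases hlS : l ∈ S <;> simp [hl, hlS]
      · simp

/-! ### Cubes and smoothing by a Lipschitz weight. -/

theorem closedBall_subset_cube {n : ℕ} {b : ℝ} (hb : 0 ≤ b) :
    Metric.closedBall (fun _ : Fin n => b / 2) (b / 2) ⊆ cube n b := by
  intro x hx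
  rw [Metric.mem_closedBall, dist_pi_le_iff (by positivity)] at hx
  have h : ∀ i, |x i - b / 2| ≤ b / 2 := fun i => hx i
  refine ⟨fun i => ?_, fun i => ?_⟩
  · have := (abs_le.1 (h i)).1
    simp only [Pi.zero_apply]
    linarith
  · have := (abs_le.1 (h i)).2
    simp only
    linarith

theorem interior_cube_nonempty (n : ℕ) {b : ℝ} (hb : 0 < b) : (interior (cube n b)).Nonempty :=
  ⟨_, interior_mono (Metric.ball_subset_closedBall.trans (closedBall_subset_cube hb.le))
    (by rw [Metric.isOpen_ball.interior_eq]; exact Metric.mem_ball_self (by positivity))⟩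

theorem cube_mono {n : ℕ} {b c : ℝ} (h : b ≤ c) : cube n b ⊆ cube n c :=
  Icc_subset_Icc_right fun _ => h

/-- A nonnegative Lipschitz weight supported in the cube. -/
noncomputable def weight (n : ℕ) (b : ℝ) (u : Fin n → ℝ) : ℝ := Metric.infDist u (cube n b)ᶜ

theorem continuous_weight (n : ℕ) (b : ℝ) : Continuous (weight n b) :=
  Metric.continuous_infDist_pt _

theorem weight_nonneg {n : ℕ} {b : ℝ} (u : Fin n → ℝ) : 0 ≤ weight n b u := Metric.infDist_nonneg

theorem weight_eq_zero {n : ℕ} {b : ℝ} {u : Fin n → ℝ} (hu : u ∉ cube n b) : weight n b u = 0 :=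
  Metric.infDist_zero_of_mem hu

theorem hasCompactSupport_weight (n : ℕ) (b : ℝ) : HasCompactSupport (weight n b) :=
  HasCompactSupport.intro isCompact_Icc fun _ hu => weight_eq_zero hu

theorem integrable_weight (n : ℕ) (b : ℝ) : Integrable (weight n b) :=
  (continuous_weight n b).integrable_of_hasCompactSupport (hasCompactSupport_weight n b)

theorem integral_weight_pos {n : ℕ} (hn : n ≠ 0) {b : ℝ} (hb : 0 < b) :
    0 < ∫ u, weight n b u := by
  refine (continuous_weight n b).integral_pos_of_hasCompactSupport_nonneg_nonzero
    (hasCompactSupport_weight n b) weight_nonneg (x := fun _ => b / 2) ?_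
  -- For `n = 0` the cube is the whole space and `infDist` to the empty set is `0`, so `n ≠ 0` is
  -- needed here.
  have hne : ((cube n b)ᶜ).Nonempty := by
    refine ⟨fun _ => -1, fun h => ?_⟩
    have := h.1 ⟨0, Nat.pos_of_ne_zero hn⟩
    norm_num at this
  have hball : Metric.ball (fun _ : Fin n => b / 2) (b / 2) ⊆ cube n b :=
    Metric.ball_subset_closedBall.trans (closedBall_subset_cube hb.le)
  have : b / 2 ≤ weight n b (fun _ => b / 2) := by
    refine (Metric.le_infDist hne).2 fun y hy => ?_
    by_contra hlt
    rw [not_le, dist_comm] at hlt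
    exact hy (hball hlt)
  linarith

theorem integral_abs_weight_sub_le (n : ℕ) (b : ℝ) (t : Fin n → ℝ) :
    ∫ u, |weight n b (u - t) - weight n b u| ≤ 2 * volume.real (cube n b) * ‖t‖ := by
  have hint : Integrable ((cube n b).indicator fun _ => (1 : ℝ)) :=
    (integrable_indicator_iff measurableSet_Icc).2
      (integrableOn_const isCompact_Icc.measure_lt_top.ne)
  have hint' := hint.comp_sub_right t
  have hle : ∀ u, |weight n b (u - t) - weight n b u| ≤
      ((cube n b).indicator (fun _ => (1 : ℝ)) (u - t) +
        (cube n b).indicator (fun _ => (1 : ℝ)) u) * ‖t‖ := by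
    intro u
    have hlip : |weight n b (u - t) - weight n b u| ≤ ‖t‖ := by
      have := (Metric.lipschitz_infDist_pt (cube n b)ᶜ).dist_le_mul (u - t) u
      rw [Real.dist_eq, dist_eq_norm] at this
      simpa [weight] using this
    have h0 := norm_nonneg t
    by_cases h1 : u - t ∈ cube n b
    · have h2 : 0 ≤ (cube n b).indicator (fun _ => (1 : ℝ)) u :=
        indicator_nonneg (fun _ _ => zero_le_one) _
      rw [indicator_of_mem h1]
      nlinarith
    · by_cases h2 : u ∈ cube n b
      · rw [indicator_of_mem h2, indicator_of_notMem h1]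
        linarith
      · rw [weight_eq_zero h1, weight_eq_zero h2, indicator_of_notMem h1, indicator_of_notMem h2]
        simp
  have hw := integrable_weight n b
  calc ∫ u, |weight n b (u - t) - weight n b u|
      ≤ ∫ u, ((cube n b).indicator (fun _ => (1 : ℝ)) (u - t) +
        (cube n b).indicator (fun _ => (1 : ℝ)) u) * ‖t‖ :=
        integral_mono ((hw.comp_sub_right t).sub hw).abs ((hint'.add hint).mul_const _) hle
    _ = 2 * volume.real (cube n b) * ‖t‖ := by
        rw [integral_mul_const, integral_add hint' hint,
          integral_sub_right_eq_self (fun u => (cube n b).indicator (fun _ => (1 : ℝ)) u) t,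
          integral_indicator_const _ measurableSet_Icc, smul_eq_mul, mul_one, two_mul]

theorem integrable_weight_mul {n : ℕ} (b : ℝ) {h : (Fin n → ℝ) → ℝ} (hh : Measurable h) {M : ℝ}
    (hM : ∀ x, |h x| ≤ M) : Integrable (fun u => weight n b u * h u) :=
  (integrable_weight n b).mul_bdd hh.aestronglyMeasurable (Filter.Eventually.of_forall hM)

/-- Moving `x` to `x'` amounts to translating `u` by `(x' - x) / k`. The translation is transferred
to the weight, so the average is Lipschitz in `x` although `h` is merely bounded and measurable. -/
theorem abs_integral_weight_mul_sub_le {n : ℕ} {b : ℝ} {h : (Fin n → ℝ) → ℝ} (hh : Measurable h)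
    {M : ℝ} (hM : ∀ x, |h x| ≤ M) {k : Fin n → ℕ} (hk : ∀ i, 1 ≤ k i) (x x' : Fin n → ℝ) :
    |(∫ u, weight n b u * h (shiftPt k x' u)) - ∫ u, weight n b u * h (shiftPt k x u)| ≤
      M * (2 * volume.real (cube n b)) * ‖x' - x‖ := by
  have hk0 : ∀ i, (1 : ℝ) ≤ k i := fun i => by exact_mod_cast hk i
  have hM0 : 0 ≤ M := (abs_nonneg _).trans (hM 0)
  set t : Fin n → ℝ := fun i => (x' i - x i) / k i with ht
  have htn : ‖t‖ ≤ ‖x' - x‖ := by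
    refine (pi_norm_le_iff_of_nonneg (norm_nonneg _)).2 fun i => ?_
    rw [ht, norm_div, Real.norm_of_nonneg (by positivity : (0 : ℝ) ≤ k i)]
    refine (div_le_self (norm_nonneg _) (hk0 i)).trans ?_
    exact norm_le_pi_norm (x' - x) i
  have hms : ∀ x, Measurable fun u => h (shiftPt k x u) := fun x =>
    hh.comp (by unfold shiftPt; fun_prop)
  have hi : ∀ x, Integrable fun u => weight n b u * h (shiftPt k x u) := fun x =>
    integrable_weight_mul b (hms x) fun _ => hM _
  have hshift : ∫ u, weight n b u * h (shiftPt k x' u)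
      = ∫ u, weight n b (u - t) * h (shiftPt k x u) := by
    rw [← integral_sub_right_eq_self (fun u => weight n b u * h (shiftPt k x' u)) t]
    congr 1
    ext u
    congr 2
    ext i
    have := hk0 i
    have h0 : (k i : ℝ) ≠ 0 := by positivity
    simp only [shiftPt, ht, Pi.sub_apply]
    field_simp
    ring
  have hi2 : Integrable fun u => weight n b (u - t) * h (shiftPt k x u) :=
    ((integrable_weight n b).comp_sub_right t).mul_bdd (hms x).aestronglyMeasurable
      (Filter.Eventually.of_forall fun _ => hM _)
  rw [hshift, ← integral_sub hi2 (hi x)]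
  refine (abs_integral_le_integral_abs).trans ?_
  have hw := integrable_weight n b
  calc ∫ u, |weight n b (u - t) * h (shiftPt k x u) - weight n b u * h (shiftPt k x u)|
      ≤ ∫ u, M * |weight n b (u - t) - weight n b u| := by
        refine integral_mono (hi2.sub (hi x)).abs
          (((hw.comp_sub_right t).sub hw).abs.const_mul _) fun u => ?_
        simp only
        rw [← sub_mul, abs_mul, mul_comm]
        exact mul_le_mul_of_nonneg_right (hM _) (abs_nonneg _)
    _ = M * ∫ u, |weight n b (u - t) - weight n b u| := integral_const_mul _ _
    _ ≤ M * (2 * volume.real (cube n b) * ‖x' - x‖) := by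
        refine mul_le_mul_of_nonneg_left ((integral_abs_weight_sub_le n b t).trans ?_) hM0
        gcongr
    _ = _ := by ring

/-! ### Compactness for sequences with vanishing differences. -/

/-- A bound in `L^p` gives a bound off a set of small measure. -/
theorem exists_volume_abs_gt_le {α : Type*} [MeasurableSpace α] {p : ℝ≥0∞} (hp : p ≠ 0) {c : ℝ≥0∞}
    (hc : c ≠ 0) (W : ℝ≥0) : ∃ θ : ℝ, ∀ (μ : Measure α) (g : α → ℝ), Measurable g →
      eLpNorm g p μ ≤ W → μ {y | θ < |g y|} ≤ c := by
  rcases eq_or_ne p ∞ with rfl | hp'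
  · refine ⟨W, fun μ g hg hW => ?_⟩
    rw [eLpNorm_exponent_top] at hW
    refine le_of_eq_of_le (measure_mono_null ?_ (enorm_ae_le_eLpNormEssSup g μ)) zero_le
    intro y hy hle
    have h1 := hle.trans hW
    rw [← ofReal_norm, Real.norm_eq_abs, ENNReal.ofReal_le_coe] at h1
    exact absurd hy (not_lt.2 h1)
  · have hpos : 0 < p.toReal := ENNReal.toReal_pos hp hp'
    have hlim : Filter.Tendsto (fun N : ℕ => ((N : ℝ≥0∞)⁻¹) ^ p.toReal * (W : ℝ≥0∞) ^ p.toReal)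
        Filter.atTop (nhds 0) := by
      have h1 := (ENNReal.continuous_rpow_const (y := p.toReal)).tendsto 0 |>.comp
        ENNReal.tendsto_inv_nat_nhds_zero
      rw [ENNReal.zero_rpow_of_pos hpos] at h1
      have h2 := ENNReal.Tendsto.mul_const (b := (W : ℝ≥0∞) ^ p.toReal) h1
        (Or.inr (ENNReal.rpow_ne_top_of_nonneg hpos.le ENNReal.coe_ne_top))
      rwa [zero_mul] at h2
    obtain ⟨N, hN, hN0⟩ := ((hlim.eventually (gt_mem_nhds (pos_iff_ne_zero.2 hc))).and
      (Filter.eventually_ge_atTop 1)).exists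
    refine ⟨N, fun μ g hg hW => ?_⟩
    have h1 := meas_ge_le_mul_pow_eLpNorm_enorm μ hp hp' hg.aestronglyMeasurable
      (ε := (N : ℝ≥0∞)) (by exact_mod_cast (by omega : N ≠ 0)) (by simp)
    refine (measure_mono fun y hy => ?_).trans (h1.trans ((?_ : _ ≤ _).trans hN.le))
    · rw [mem_ofPred_eq] at hy ⊢
      rw [← ofReal_norm, Real.norm_eq_abs, ← ENNReal.ofReal_natCast]
      exact ENNReal.ofReal_le_ofReal hy.le
    · gcongr

/-- If the remainders tend to zero, then the functions are eventually bounded at almost every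
point. -/
theorem ShiftRep.ae_eventually_abs_le {n r : ℕ} {p : ℝ≥0∞} (R : ShiftRep n r p Finset.univ)
    (hr : 1 ≤ r) {b θ : ℝ} (hb : 0 < b) {g : ℕ → (Fin n → ℝ) → ℝ} (hg : ∀ k, Measurable (g k))
    (hsmall : letI := R.fintype; ∀ k, volume {y | y ∈ cube n (2 * b) ∧ θ < |g k y|} ≤
      volume (cube n (b / r)) / (2 * (Fintype.card R.ι + 1)))
    (herr : ∀ᵐ z ∂((volume.restrict (cube n b)).prod (volume.restrict (cube n (b / r)))),
      Filter.Tendsto (fun k => R.err (g k) z) Filter.atTop (nhds 0)) :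
    ∀ᵐ x ∂(volume.restrict (cube n b)), ∀ᶠ k in Filter.atTop,
      |g k x| ≤ R.coeffSum * θ + 1 := by
  have hr0 : (0 : ℝ) < r := by exact_mod_cast hr
  have hU0 := volume_cube_ne_zero n (div_pos hb hr0)
  have hU2 : volume (cube n (b / r)) / 2 ≠ 0 := by simp [ENNReal.div_eq_zero_iff, hU0]
  have : IsFiniteMeasure (volume.restrict (cube n (b / r))) :=
    ⟨by rw [Measure.restrict_apply_univ]; exact isCompact_Icc.measure_lt_top⟩
  filter_upwards [Measure.ae_ae_of_ae_prod herr, ae_restrict_mem measurableSet_Icc] with x hx hxX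
  have hm := tendstoInMeasure_of_tendsto_ae (μ := volume.restrict (cube n (b / r)))
    (f := fun k u => R.err (g k) (x, u)) (g := fun _ => 0)
    (fun k => ((R.measurable_err (hg k)).comp measurable_prodMk_left).aestronglyMeasurable) hx
  -- Eventually the remainder reaches `1` on less than half of the steps, so some step in the good
  -- half has remainder below `1`.
  have h1 := hm 1 one_pos
  filter_upwards [h1.eventually (gt_mem_nhds (pos_iff_ne_zero.2 hU2))] with k hk
  by_contra hlt
  rw [not_le] at hlt
  refine absurd ((R.half_le_volume hr (hsmall k) hxX).trans (measure_mono fun u hu => ?_))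
    (not_le.2 hk)
  rw [mem_ofPred_eq] at hu ⊢
  rw [edist_dist, Real.dist_eq, sub_zero, ENNReal.one_le_ofReal]
  linarith

/-- A bounded sequence whose remainders tend to zero has a subsequence that converges almost
everywhere to a continuous function. -/
theorem ShiftRep.exists_subseq_tendsto {n r : ℕ} (hn : n ≠ 0) {p : ℝ≥0∞}
    (R : ShiftRep n r p Finset.univ) (hr : 1 ≤ r) {c M : ℝ} (hc : 0 < c)
    {h : ℕ → (Fin n → ℝ) → ℝ} (hm : ∀ k, Measurable (h k)) (hM : ∀ k x, |h k x| ≤ M)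
    (herr : ∀ᵐ x ∂(volume.restrict (cube n c)), ∀ᵐ u ∂(volume.restrict (cube n (c / r))),
      Filter.Tendsto (fun k => R.err (h k) (x, u)) Filter.atTop (nhds 0)) :
    ∃ (ns : ℕ → ℕ) (F : (Fin n → ℝ) → ℝ), StrictMono ns ∧ ContinuousOn F (cube n c) ∧
      ∀ᵐ x ∂(volume.restrict (cube n c)),
        Filter.Tendsto (fun k => h (ns k) x) Filter.atTop (nhds (F x)) := by
  let := R.fintype
  have hr0 : (0 : ℝ) < r := by exact_mod_cast hr
  have hM0 : 0 ≤ M := (abs_nonneg _).trans (hM 0 0)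
  set w := weight n (c / r) with hw
  set I : ℝ := ∫ u, w u with hI
  have hI0 : 0 < I := integral_weight_pos hn (div_pos hc hr0)
  have hms : ∀ k m x, Measurable fun u => h k (shiftPt (R.mult m) x u) := fun k m x =>
    (hm k).comp (by unfold shiftPt; fun_prop)
  have hint : ∀ k m x, Integrable fun u => w u * h k (shiftPt (R.mult m) x u) := fun k m x =>
    integrable_weight_mul _ (hms k m x) fun _ => hM k _
  -- The representation of `h k` without its remainder, averaged over `u` with the normalized
  -- weight. These functions are uniformly bounded and equi-Lipschitz.
  set T : ℕ → (Fin n → ℝ) → ℝ := fun k x =>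
    I⁻¹ * ∑ m, R.coeff m * ∫ u, w u * h k (shiftPt (R.mult m) x u) with hT
  have hTbound : ∀ k x, |T k x| ≤ R.coeffSum * M := by
    intro k x
    have h1 : ∀ m, |∫ u, w u * h k (shiftPt (R.mult m) x u)| ≤ I * M := by
      intro m
      refine abs_integral_le_integral_abs.trans ?_
      rw [hI, ← integral_mul_const]
      refine integral_mono (hint k m x).abs ((integrable_weight n _).mul_const M) fun u => ?_
      simp only
      rw [abs_mul, abs_of_nonneg (weight_nonneg u)]
      exact mul_le_mul_of_nonneg_left (hM _ _) (weight_nonneg u)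
    rw [hT]
    simp only
    rw [abs_mul, abs_of_pos (inv_pos.2 hI0), inv_mul_le_iff₀ hI0, coeffSum, Finset.sum_mul,
      Finset.mul_sum]
    refine (Finset.abs_sum_le_sum_abs _ _).trans (Finset.sum_le_sum fun m _ => ?_)
    rw [abs_mul, mul_left_comm]
    exact mul_le_mul_of_nonneg_left (h1 m) (abs_nonneg _)
  set L : ℝ := I⁻¹ * (R.coeffSum * (M * (2 * volume.real (cube n (c / r))))) with hL
  have hL0 : 0 ≤ L := by have := R.coeffSum_nonneg; positivity
  have hTlip : ∀ k x x', |T k x' - T k x| ≤ L * ‖x' - x‖ := by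
    intro k x x'
    have h1 : T k x' - T k x = I⁻¹ * ∑ m, R.coeff m *
        ((∫ u, w u * h k (shiftPt (R.mult m) x' u)) -
          ∫ u, w u * h k (shiftPt (R.mult m) x u)) := by
      simp only [hT, mul_sub, Finset.sum_sub_distrib]
    rw [h1, abs_mul, abs_of_pos (inv_pos.2 hI0), hL, mul_assoc]
    refine mul_le_mul_of_nonneg_left ?_ (inv_pos.2 hI0).le
    refine (Finset.abs_sum_le_sum_abs _ _).trans ?_
    rw [coeffSum, mul_assoc, Finset.sum_mul]
    refine Finset.sum_le_sum fun m _ => ?_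
    rw [abs_mul]
    exact mul_le_mul_of_nonneg_left (abs_integral_weight_mul_sub_le (hm k) (hM k)
      (fun i => R.one_le m i (Finset.mem_univ i)) x x') (abs_nonneg _)
  -- `h k - T k` is the weighted average of the remainder, which tends to zero by dominated
  -- convergence.
  have hclose : ∀ᵐ x ∂(volume.restrict (cube n c)),
      Filter.Tendsto (fun k => h k x - T k x) Filter.atTop (nhds 0) := by
    filter_upwards [herr] with x hx
    have h1 : ∀ k, h k x - T k x = I⁻¹ * ∫ u, w u * R.err (h k) (x, u) := by
      intro k
      have h2 : ∀ u, w u * R.err (h k) (x, u) = w u * h k x -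
          ∑ m, R.coeff m * (w u * h k (shiftPt (R.mult m) x u)) := by
        intro u
        simp only [err, mul_sub, Finset.mul_sum]
        congr 1
        exact Finset.sum_congr rfl fun m _ => by ring
      simp only [h2]
      rw [integral_sub ((integrable_weight n _).mul_const _)
        (integrable_finsetSum _ fun m _ => (hint k m x).const_mul _),
        integral_finsetSum _ fun m _ => (hint k m x).const_mul _, integral_mul_const, mul_sub,
        ← mul_assoc, ← hI, inv_mul_cancel₀ hI0.ne', one_mul]
      simp only [hT, integral_const_mul]
    simp only [h1]
    rw [← mul_zero I⁻¹]
    refine Filter.Tendsto.const_mul _ ?_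
    have h3 := tendsto_integral_of_dominated_convergence (μ := volume)
      (F := fun k u => w u * R.err (h k) (x, u)) (f := fun _ => 0)
      (fun u => w u * (M + R.coeffSum * M)) ?_ ((integrable_weight n _).mul_const _) ?_ ?_
    · simpa using h3
    · intro k
      exact ((continuous_weight n _).measurable.mul
        ((R.measurable_err (hm k)).comp measurable_prodMk_left)).aestronglyMeasurable
    · refine fun k => Filter.Eventually.of_forall fun u => ?_
      rw [norm_mul, Real.norm_of_nonneg (weight_nonneg u)]
      refine mul_le_mul_of_nonneg_left ?_ (weight_nonneg u)
      refine (abs_sub _ _).trans (add_le_add (hM k x) ?_)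
      exact R.abs_sum_le fun m => hM k _
    · rw [ae_restrict_iff' measurableSet_Icc] at hx
      filter_upwards [hx] with u hu
      by_cases huU : u ∈ cube n (c / r)
      · simpa using (hu huU).const_mul (w u)
      · simp [hw, weight_eq_zero huU]
  let K := cube n c
  have : CompactSpace K := isCompact_iff_compactSpace.1 isCompact_Icc
  have hTlipK : ∀ k, LipschitzWith L.toNNReal (fun x : K => T k x) := by
    intro k
    refine LipschitzWith.of_dist_le_mul fun x x' => ?_
    rw [Real.dist_eq, Real.coe_toNNReal _ hL0, Subtype.dist_eq, dist_eq_norm]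
    exact hTlip k x' x
  let G : ℕ → BoundedContinuousFunction K ℝ := fun k =>
    BoundedContinuousFunction.mkOfCompact ⟨fun x : K => T k x, (hTlipK k).continuous⟩
  have hcomp : IsCompact (closure (range G)) := by
    refine BoundedContinuousFunction.arzela_ascoli (Icc (-(R.coeffSum * M)) (R.coeffSum * M))
      isCompact_Icc (range G) ?_ ?_
    · rintro _ x ⟨k, rfl⟩
      exact abs_le.1 (hTbound k x)
    · refine (LipschitzWith.uniformEquicontinuous _ L.toNNReal ?_).equicontinuous
      rintro ⟨_, k, rfl⟩
      exact hTlipK k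
  obtain ⟨F, -, ns, hns, hlim⟩ := hcomp.tendsto_subseq (x := G)
    fun k => subset_closure (mem_range_self k)
  refine ⟨ns, Function.extend Subtype.val F 0, hns, ?_, ?_⟩
  · rw [continuousOn_iff_continuous_domRestrict]
    refine F.continuous.congr fun x => ?_
    exact (Subtype.val_injective.extend_apply _ _ x).symm
  · filter_upwards [hclose, ae_restrict_mem measurableSet_Icc] with x hx hxK
    have h1 : Filter.Tendsto (fun k => T (ns k) x) Filter.atTop (nhds (F ⟨x, hxK⟩)) :=
      ((continuous_eval_const (⟨x, hxK⟩ : K)).tendsto F).comp hlim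
    have h2 := (hx.comp hns.tendsto_atTop).add h1
    have h3 : Function.extend Subtype.val F 0 x = F ⟨x, hxK⟩ :=
      Subtype.val_injective.extend_apply F 0 (⟨x, hxK⟩ : K)
    rw [h3]
    simpa using h2

/-- A continuous almost everywhere limit of functions whose differences tend to zero is a
polynomial. -/
theorem exists_coordPoly_of_ae_tendsto {n r : ℕ} (hr : 1 ≤ r) {p : ℝ≥0∞} (hp : p ≠ 0) {c : ℝ}
    (hc : 0 < c) {g : ℕ → (Fin n → ℝ) → ℝ} (hg : ∀ k, Measurable (g k)) {ε : ℕ → ℝ≥0∞}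
    (hε : Filter.Tendsto ε Filter.atTop (nhds 0)) (hd : ∀ k, DiffBound (cube n c) r (g k) p (ε k))
    {F : (Fin n → ℝ) → ℝ} (hF : ContinuousOn F (cube n c))
    (hlim : ∀ᵐ x ∂(volume.restrict (cube n c)),
      Filter.Tendsto (fun k => g k x) Filter.atTop (nhds (F x))) :
    ∃ P ∈ coordPoly n r, ∀ x ∈ cube n c, F x = MvPolynomial.eval x P := by
  refine exists_coordPoly_eqOn hr hc hF fun i u x hu hru hx hxu => ?_
  set D : Set (Fin n → ℝ) := {x | x ∈ cube n c ∧ x + (r : ℝ) • Pi.single i u ∈ cube n c} with hD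
  have hr0 : (0 : ℝ) < r := by exact_mod_cast hr
  have hconvK : Convex ℝ (cube n c) := convex_Icc 0 _
  have hDinter : D = cube n c ∩ (fun x => x + (r : ℝ) • Pi.single i u) ⁻¹' cube n c := rfl
  have hDconv : Convex ℝ D := by
    rw [hDinter]
    exact hconvK.inter (hconvK.translate_preimage_left _)
  have hDclosed : IsClosed D := by
    rw [hDinter]
    exact isClosed_Icc.inter (isClosed_Icc.preimage (continuous_add_const _))
  have hDmem : ∀ x ∈ D, ∀ j ∈ Finset.range (r + 1),
      x + (j : ℝ) • Pi.single i u ∈ cube n c := by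
    intro x hx j hj
    have hjr : (j : ℝ) / r ≤ 1 := by
      rw [div_le_one hr0]
      exact_mod_cast Nat.lt_succ_iff.1 (Finset.mem_range.1 hj)
    have h1 := hconvK.add_smul_sub_mem hx.1 hx.2 ⟨by positivity, hjr⟩
    rwa [add_sub_cancel_left, smul_smul, div_mul_cancel₀ _ hr0.ne'] at h1
  -- `D` contains a cube of side `c - r * u`, which is positive because of the strict inequality on
  -- the step.
  have hDint : (interior D).Nonempty := by
    refine (interior_cube_nonempty n (sub_pos.2 hru)).mono (interior_mono fun x hx => ?_)
    have h1 : x ∈ cube n c := cube_mono (by nlinarith) hx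
    refine ⟨h1, fun l => ?_, fun l => ?_⟩
    · rcases eq_or_ne l i with rfl | hl
      · have := h1.1 l
        simp only [Pi.zero_apply] at this
        simp only [Pi.zero_apply, Pi.add_apply, Pi.smul_apply, Pi.single_eq_same, smul_eq_mul]
        positivity
      · simpa [hl] using h1.1 l
    · rcases eq_or_ne l i with rfl | hl
      · have := hx.2 l
        simp only at this
        simp only [Pi.add_apply, Pi.smul_apply, Pi.single_eq_same, smul_eq_mul]
        linarith
      · simpa [hl] using h1.2 l
  have hFD : ContinuousOn (finDiff r (Pi.single i u) F) D := by
    unfold finDiff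
    refine continuousOn_finsetSum _ fun j hj => ContinuousOn.mul continuousOn_const ?_
    exact hF.comp (continuous_add_const _).continuousOn fun x hx => hDmem x hx j hj
  have hlimD : ∀ᵐ x ∂(volume.restrict D), Filter.Tendsto
      (fun k => finDiff r (Pi.single i u) (g k) x) Filter.atTop
      (nhds (finDiff r (Pi.single i u) F x)) := by
    have h1 : ∀ j ∈ Finset.range (r + 1), ∀ᵐ x ∂(volume.restrict D), Filter.Tendsto
        (fun k => g k (x + (j : ℝ) • Pi.single i u)) Filter.atTop
        (nhds (F (x + (j : ℝ) • Pi.single i u))) := by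
      intro j hj
      rw [ae_restrict_iff' measurableSet_Icc] at hlim
      have h2 := (measurePreserving_add_right volume
        ((j : ℝ) • (Pi.single i u : Fin n → ℝ))).quasiMeasurePreserving.ae hlim
      rw [ae_restrict_iff' hDclosed.measurableSet]
      filter_upwards [h2] with x hx hxD
      exact hx (hDmem x hxD j hj)
    have h2 := (Filter.eventually_all_finset _).2 h1
    filter_upwards [h2] with x hx
    exact tendsto_finsetSum _ fun j hj => (hx j hj).const_mul _
  -- Fatou's lemma for the norms. Continuity of `F` then upgrades almost everywhere vanishing to
  -- vanishing on all of `D`.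
  have hzero : eLpNorm (finDiff r (Pi.single i u) F) p (volume.restrict D) = 0 := by
    refine le_antisymm ((Lp.eLpNorm_lim_le_liminf_eLpNorm
      (fun k => (Measurable.finDiff (hg k) _).aestronglyMeasurable) _ hlimD).trans ?_) zero_le
    refine (Filter.liminf_le_liminf (Filter.Eventually.of_forall fun k => hd k i u)).trans ?_
    exact hε.liminf_eq.le
  rw [eLpNorm_eq_zero_iff (hFD.aestronglyMeasurable hDclosed.measurableSet) hp] at hzero
  have h2 := Measure.eqOn_of_ae_eq hzero hFD continuousOn_const (by
    rw [hDconv.closure_interior_eq_closure_of_nonempty_interior hDint]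
    exact subset_closure)
  exact h2 ⟨hx, hxu⟩

theorem exists_subseq_tendsto_coordPoly {n r : ℕ} (hn : n ≠ 0) (hr : 1 ≤ r) {p : ℝ≥0∞} (hp : p ≠ 0)
    {g : ℕ → (Fin n → ℝ) → ℝ} (hg : ∀ k, Measurable (g k)) {ε : ℕ → ℝ≥0∞}
    (hε : Filter.Tendsto ε Filter.atTop (nhds 0))
    (hb : ∀ k, eLpNorm (g k) p (volume.restrict (cube n 1)) ≤ 2)
    (hd : ∀ k, DiffBound (cube n 1) r (g k) p (ε k)) :
    ∃ P ∈ coordPoly n r, ∃ ns : ℕ → ℕ, StrictMono ns ∧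
      ∀ᵐ x ∂(volume.restrict (cube n (1 / 4))),
        Filter.Tendsto (fun k => g (ns k) x) Filter.atTop (nhds (MvPolynomial.eval x P)) := by
  obtain ⟨R⟩ := nonempty_shiftRep n hr hp Finset.univ
  let := R.fintype
  have hr0 : (0 : ℝ) < r := by exact_mod_cast hr
  have h21 : (2 : ℝ) * (1 / 2) = 1 := by norm_num
  obtain ⟨C, hC⟩ := R.error_le (1 / 2)
  rw [h21] at hC
  have htm : TendstoInMeasure ((volume.restrict (cube n (1 / 2))).prod
      (volume.restrict (cube n (1 / 2 / r)))) (fun k => R.err (g k)) Filter.atTop (fun _ => 0) := by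
    refine tendstoInMeasure_of_tendsto_eLpNorm hp
      (fun k => (R.measurable_err (hg k)).aestronglyMeasurable) aestronglyMeasurable_const ?_
    have h1 : Filter.Tendsto (fun k => (C : ℝ≥0∞) * ε k) Filter.atTop (nhds 0) := by
      simpa using ENNReal.Tendsto.const_mul hε (Or.inr (ENNReal.coe_ne_top (r := C)))
    refine tendsto_of_tendsto_of_tendsto_of_le_of_le tendsto_const_nhds h1 (fun _ => zero_le)
      fun k => ?_
    refine le_of_eq_of_le ?_ (hC (hg k) (hd k))
    congr 1
    ext z
    simp [ShiftRep.err]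
  obtain ⟨ns₁, hns₁, herr⟩ := htm.exists_seq_tendsto_ae
  obtain ⟨θ, hθ⟩ := exists_volume_abs_gt_le (α := Fin n → ℝ) hp
    (c := volume (cube n (1 / 2 / r)) / (2 * (Fintype.card R.ι + 1))) (by
      rw [Ne, ENNReal.div_eq_zero_iff, not_or]
      exact ⟨volume_cube_ne_zero n (by positivity), ENNReal.mul_ne_top (by simp) (by simp)⟩) 2
  have hev := R.ae_eventually_abs_le hr (b := 1 / 2) (θ := θ) (by norm_num)
    (g := fun k => g (ns₁ k)) (fun k => hg _) (fun k => by
      have h1 := hθ (volume.restrict (cube n 1)) (g (ns₁ k)) (hg _) (hb _)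
      rw [h21]
      rw [Measure.restrict_apply' measurableSet_Icc, inter_comm] at h1
      exact h1) herr
  set M : ℝ := max (R.coeffSum * θ + 1) 0 with hMdef
  have hM0 : 0 ≤ M := le_max_right _ _
  -- The truncation sets large values to zero. It makes integrals available when `p < 1`, and at
  -- almost every point it changes only finitely many terms.
  set h : ℕ → (Fin n → ℝ) → ℝ := fun k =>
    {x | |g (ns₁ k) x| ≤ M}.indicator (g (ns₁ k)) with hh
  have hhm : ∀ k, Measurable (h k) := fun k => (hg _).indicator
    (measurableSet_le (hg _).abs measurable_const)
  have hhM : ∀ k x, |h k x| ≤ M := by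
    intro k x
    by_cases hx : x ∈ {x | |g (ns₁ k) x| ≤ M}
    · simp only [hh, indicator_of_mem hx]
      exact hx
    · simpa only [hh, indicator_of_notMem hx, abs_zero] using hM0
  have hheq : ∀ᵐ x ∂(volume.restrict (cube n (1 / 2))), ∀ᶠ k in Filter.atTop,
      h k x = g (ns₁ k) x := by
    filter_upwards [hev] with x hx
    filter_upwards [hx] with k hk
    exact indicator_of_mem (s := {x | |g (ns₁ k) x| ≤ M}) (hk.trans (le_max_left _ _)) _
  have hherr : ∀ᵐ x ∂(volume.restrict (cube n (1 / 4))),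
      ∀ᵐ u ∂(volume.restrict (cube n (1 / 4 / r))),
      Filter.Tendsto (fun k => R.err (h k) (x, u)) Filter.atTop (nhds 0) := by
    have h42 : cube n (1 / 4) ⊆ cube n (1 / 2) := cube_mono (by norm_num)
    have h42' : cube n (1 / 4 / r) ⊆ cube n (1 / 2 / r) := cube_mono (by gcongr; norm_num)
    have hnull : volume {x | ¬ (x ∈ cube n (1 / 2) → ∀ᶠ k in Filter.atTop,
        h k x = g (ns₁ k) x)} = 0 := (ae_restrict_iff' measurableSet_Icc).1 hheq
    filter_upwards [ae_restrict_of_ae_restrict_of_subset h42 hheq,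
      ae_restrict_of_ae_restrict_of_subset h42 (Measure.ae_ae_of_ae_prod herr),
      ae_restrict_mem measurableSet_Icc] with x hx hx2 hxX
    -- The points where truncation matters infinitely often form a null set, and
    -- `volume_shiftPt_preimage_le` makes its preimage in the step variable null.
    have hall : ∀ m, ∀ᵐ u ∂(volume.restrict (cube n (1 / 4 / r))), ∀ᶠ k in Filter.atTop,
        h k (shiftPt (R.mult m) x u) = g (ns₁ k) (shiftPt (R.mult m) x u) := by
      intro m
      rw [ae_restrict_iff' measurableSet_Icc]
      have h1 : volume {u | shiftPt (R.mult m) x u ∈ {x | ¬ (x ∈ cube n (1 / 2) →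
          ∀ᶠ k in Filter.atTop, h k x = g (ns₁ k) x)}} = 0 :=
        le_antisymm ((volume_shiftPt_preimage_le
          (fun i => R.one_le m i (Finset.mem_univ i)) x _).trans hnull.le) zero_le
      have h2 : ∀ᵐ u, (shiftPt (R.mult m) x u ∈ cube n (1 / 2) → ∀ᶠ k in Filter.atTop,
          h k (shiftPt (R.mult m) x u) = g (ns₁ k) (shiftPt (R.mult m) x u)) := h1
      filter_upwards [h2] with u hu huU
      refine hu ?_
      have := shiftPt_mem_cube hr (R.le_order m) hxX huU
      rwa [show (2 : ℝ) * (1 / 4) = 1 / 2 by norm_num] at this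
    filter_upwards [ae_restrict_of_ae_restrict_of_subset h42' hx2,
      Filter.eventually_all.2 hall] with u hu hum
    refine hu.congr' ?_
    filter_upwards [hx, Filter.eventually_all.2 hum] with k hk hkm
    simp only [ShiftRep.err, hk, hkm]
  obtain ⟨ns₂, F, hns₂, hF, hlim⟩ := R.exists_subseq_tendsto hn hr (by norm_num) hhm hhM hherr
  have hglim : ∀ᵐ x ∂(volume.restrict (cube n (1 / 4))),
      Filter.Tendsto (fun k => g (ns₁ (ns₂ k)) x) Filter.atTop (nhds (F x)) := by
    filter_upwards [hlim, ae_restrict_of_ae_restrict_of_subset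
      (cube_mono (by norm_num : (1 : ℝ) / 4 ≤ 1 / 2)) hheq] with x hx hx2
    refine hx.congr' ?_
    exact hns₂.tendsto_atTop.eventually hx2
  have hns := hns₁.comp hns₂
  obtain ⟨P, hP, hPF⟩ := exists_coordPoly_of_ae_tendsto hr hp (c := 1 / 4) (by norm_num)
    (g := fun k => g (ns₁ (ns₂ k))) (fun k => hg _) (hε.comp hns.tendsto_atTop)
    (fun k => (hd _).mono (cube_mono (by norm_num))) hF hglim
  refine ⟨P, hP, ns₁ ∘ ns₂, hns, ?_⟩
  filter_upwards [hglim, ae_restrict_mem measurableSet_Icc] with x hx hxK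
  rw [← hPF x hxK]
  exact hx

/-! ### The Whitney inequality in coordinates. -/

theorem measurable_sub_eval {n : ℕ} {g : (Fin n → ℝ) → ℝ} (hg : Measurable g)
    (P : MvPolynomial (Fin n) ℝ) : Measurable fun x => g x - MvPolynomial.eval x P :=
  hg.sub P.continuous_eval.measurable

/-- A sequence of counterexamples with differences tending to zero would converge to a polynomial
`P` almost everywhere, hence in measure, along a subsequence. Applied to `g k - P`,
`exists_eLpNorm_le_of_volume_le` turns this into smallness in norm on the cube of side `1 / 8`. -/
theorem exists_eLpNorm_sub_coordPoly_le {n r : ℕ} (hn : n ≠ 0) (hr : 1 ≤ r) {p : ℝ≥0∞} (hp : p ≠ 0)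
    {τ : ℝ≥0∞} (hτ : τ ≠ 0) :
    ∃ η : ℝ≥0∞, η ≠ 0 ∧ ∀ g : (Fin n → ℝ) → ℝ, Measurable g →
      eLpNorm g p (volume.restrict (cube n 1)) ≤ 2 → DiffBound (cube n 1) r g p η →
      ∃ P ∈ coordPoly n r, eLpNorm (fun x => g x - MvPolynomial.eval x P) p
        (volume.restrict (cube n (1 / 8))) ≤ τ := by
  by_contra! hcon
  choose g hg hb hd hbad using fun k : ℕ => hcon ((k : ℝ≥0∞) + 1)⁻¹ (by simp)
  have hε : Filter.Tendsto (fun k : ℕ => ((k : ℝ≥0∞) + 1)⁻¹) Filter.atTop (nhds 0) := by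
    have := (Filter.tendsto_add_atTop_iff_nat 1).2 ENNReal.tendsto_inv_nat_nhds_zero
    simpa using this
  obtain ⟨P, hP, ns, hns, hlim⟩ := exists_subseq_tendsto_coordPoly hn hr hp hg hε hb hd
  obtain ⟨c, C, hc, hC⟩ := exists_eLpNorm_le_of_volume_le n hr hp (b := 1 / 8) (by norm_num)
  rw [show (2 : ℝ) * (1 / 8) = 1 / 4 by norm_num] at hC
  have hlim2 : Filter.Tendsto (fun t : ℝ≥0∞ => (C : ℝ≥0∞) * (t + t)) (nhds 0) (nhds 0) := by
    have h1 : Filter.Tendsto (fun t : ℝ≥0∞ => t + t) (nhds 0) (nhds 0) := by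
      simpa using (Filter.tendsto_id (α := ℝ≥0∞) (x := nhds 0)).add Filter.tendsto_id
    simpa using ENNReal.Tendsto.const_mul h1 (Or.inr (ENNReal.coe_ne_top (r := C)))
  obtain ⟨θ, hθ0, hθ⟩ : ∃ θ : ℝ≥0, 0 < θ ∧ (C : ℝ≥0∞) * (θ + θ) ≤ τ := by
    have h1 := hε.eventually (hlim2.eventually (gt_mem_nhds (pos_iff_ne_zero.2 hτ)))
    obtain ⟨k, hk⟩ := h1.exists
    refine ⟨((k : ℝ≥0) + 1)⁻¹, by positivity, ?_⟩
    refine le_trans (le_of_eq ?_) hk.le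
    rw [ENNReal.coe_inv (by positivity)]
    simp
  have : IsFiniteMeasure (volume.restrict (cube n (1 / 4))) :=
    ⟨by rw [Measure.restrict_apply_univ]; exact isCompact_Icc.measure_lt_top⟩
  have hm := tendstoInMeasure_of_tendsto_ae
    (fun k => (hg (ns k)).aestronglyMeasurable) hlim
  rw [tendstoInMeasure_iff_norm] at hm
  have h1 := (hm θ hθ0).eventually (gt_mem_nhds (pos_iff_ne_zero.2 hc))
  have h2 := (hε.comp hns.tendsto_atTop).eventually
    (gt_mem_nhds (ENNReal.coe_pos.2 hθ0))
  obtain ⟨k, hk1, hk2⟩ := (h1.and h2).exists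
  refine absurd (hbad (ns k) P hP) (not_lt.2 ?_)
  refine (hC (measurable_sub_eval (hg (ns k)) P)
    (((hd (ns k)).sub_coordPoly hP).mono (cube_mono (by norm_num))) (θ := θ) ?_).trans
    (le_trans ?_ hθ)
  · refine le_trans ?_ hk1.le
    rw [Measure.restrict_apply' measurableSet_Icc]
    refine measure_mono fun x hx => ⟨?_, hx.1⟩
    exact le_of_lt hx.2
  · gcongr
    exact hk2.le

theorem zero_mem_coordPoly (n r : ℕ) : (0 : MvPolynomial (Fin n) ℝ) ∈ coordPoly n r := fun _ _ =>
  ⟨0, by simp, by simp⟩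

/-- The normalized form of the Whitney inequality. -/
theorem exists_coordPoly_eLpNorm_sub_le_half {n r : ℕ} (hn : n ≠ 0) (hr : 1 ≤ r) {p : ℝ≥0∞}
    (hp : p ≠ 0) (D s : ℝ) {δ : ℝ} (hδ : 0 < δ) :
    ∃ η : ℝ≥0∞, η ≠ 0 ∧ ∀ {H : Set (Fin n → ℝ)} {g : (Fin n → ℝ) → ℝ},
      Convex ℝ H → cube n 1 ⊆ H → H ⊆ Metric.closedBall 0 D → StepProperty H r s δ →
      Measurable g → eLpNorm g p (volume.restrict H) ≤ 2 → DiffBound H r g p η →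
      ∃ P ∈ coordPoly n r,
        eLpNorm (fun x => g x - MvPolynomial.eval x P) p (volume.restrict H) ≤ 1 / 2 := by
  -- `2 * a` must not exceed `δ`, for the step property, nor `1 / 16`, the sup-norm radius of the
  -- cube of side `1 / 8`.
  set a : ℝ := min (1 / 32) (δ / 2) with ha
  have ha0 : 0 < a := lt_min (by norm_num) (by positivity)
  have ha1 : a ≤ 1 / 32 := min_le_left _ _
  have ha2 : 2 * a ≤ δ := by
    have := min_le_right (1 / 32) (δ / 2)
    linarith
  obtain ⟨K, hK⟩ := exists_eLpNorm_le_of_stepProperty n r hr hp (D := D) (s := s) ha0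
  set τ : ℝ≥0 := (4 * (K + 1))⁻¹ with hτ
  have hτ0 : 0 < τ := by positivity
  have hKτ : (K : ℝ≥0∞) * (τ + τ) ≤ 1 / 2 := by
    have : K * (τ + τ) ≤ 1 / 2 := by
      rw [hτ, ← two_mul, ← NNReal.coe_le_coe]
      push_cast
      have := K.2
      rw [show (K : ℝ) * (2 * (4 * ((K : ℝ) + 1))⁻¹) = K / (2 * (K + 1)) by field_simp; norm_num,
        div_le_div_iff₀ (by positivity) (by norm_num)]
      linarith
    have h2 : ((K * (τ + τ) : ℝ≥0) : ℝ≥0∞) ≤ ((1 / 2 : ℝ≥0) : ℝ≥0∞) := by exact_mod_cast this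
    refine le_trans (le_of_eq (by push_cast; rfl)) (h2.trans (le_of_eq ?_))
    rw [ENNReal.coe_div (by norm_num)]
    simp
  obtain ⟨η, hη0, hη⟩ := exists_eLpNorm_sub_coordPoly_le hn hr hp (n := n)
    (τ := (τ : ℝ≥0∞)) (by exact_mod_cast hτ0.ne')
  refine ⟨min η τ, by simp [hη0, hτ0.ne'], fun {H g} hH hHc hHD hst hg hb hd => ?_⟩
  obtain ⟨P, hP, hPτ⟩ := hη g hg
    ((eLpNorm_mono_measure _ (Measure.restrict_mono hHc le_rfl)).trans hb)
    (fun i u => ((hd.mono hHc) i u).trans (min_le_left _ _))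
  have hdτ : DiffBound H r g p τ := fun i u => (hd i u).trans (min_le_right _ _)
  have hball : Metric.closedBall (fun _ : Fin n => (1 : ℝ) / 8 / 2) (2 * a) ⊆ cube n (1 / 8) :=
    (Metric.closedBall_subset_closedBall (by linarith)).trans
      (closedBall_subset_cube (by norm_num))
  refine ⟨P, hP, (hK (fun _ => 1 / 8 / 2) hH hHD ?_ (measurable_sub_eval hg P)
    (hdτ.sub_coordPoly hP)
    (hball.trans ((cube_mono (by norm_num)).trans hHc)) (le_trans ?_ hPτ)).trans hKτ⟩
  · intro v hv
    obtain ⟨i, σ, hσ, h⟩ := hst v hv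
    exact ⟨i, σ, hσ, fun j hj => (Metric.closedBall_subset_closedBall ha2).trans (h j hj)⟩
  · refine eLpNorm_mono_measure _ (Measure.restrict_mono ?_ le_rfl)
    exact (Metric.closedBall_subset_closedBall (by linarith)).trans hball

/-- Homogeneity: subtract a polynomial within a factor `2` of the best error `E₀` and divide by
`E₀`. If the rescaled differences were at most `η`, the normalized statement would give a polynomial
with error at most `E₀ / 2`; hence `E₀ * η ≤ ω`. No best approximant is needed, and `E` is an
arbitrary lower bound so that a rescaled error can be inserted directly. -/
theorem exists_whitney {n r : ℕ} (hn : n ≠ 0) (hr : 1 ≤ r) {p : ℝ≥0∞}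
    (hp : p ≠ 0) (D s : ℝ) {δ : ℝ} (hδ : 0 < δ) :
    ∃ C : ℝ≥0, ∀ {H : Set (Fin n → ℝ)} {g : (Fin n → ℝ) → ℝ} {ω E : ℝ≥0∞},
      Convex ℝ H → cube n 1 ⊆ H → H ⊆ Metric.closedBall 0 D → StepProperty H r s δ →
      Measurable g → eLpNorm g p (volume.restrict H) ≠ ∞ → DiffBound H r g p ω →
      (∀ P ∈ coordPoly n r,
        E ≤ eLpNorm (fun x => g x - MvPolynomial.eval x P) p (volume.restrict H)) →
      E ≤ C * ω := by
  obtain ⟨η, hη0, hη⟩ := exists_coordPoly_eLpNorm_sub_le_half hn hr hp D s hδ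
  have hηinv : η⁻¹ ≠ ∞ := by simpa using hη0
  refine ⟨η⁻¹.toNNReal, fun {H g ω E} hH hHc hHD hst hg hfin hd hE => ?_⟩
  rw [ENNReal.coe_toNNReal hηinv]
  set E₀ : ℝ≥0∞ := ⨅ P ∈ coordPoly n r,
    eLpNorm (fun x => g x - MvPolynomial.eval x P) p (volume.restrict H) with hE₀
  have hEE₀ : E ≤ E₀ := le_iInf₂ hE
  refine hEE₀.trans ?_
  rcases eq_or_ne E₀ 0 with h0 | h0
  · rw [h0]; exact zero_le
  have hE₀fin : E₀ ≠ ∞ := by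
    refine ne_top_of_le_ne_top hfin ((iInf₂_le 0 (zero_mem_coordPoly n r)).trans (le_of_eq ?_))
    simp only [map_zero, sub_zero]
  obtain ⟨P₀, hP₀, hlt⟩ : ∃ P ∈ coordPoly n r,
      eLpNorm (fun x => g x - MvPolynomial.eval x P) p (volume.restrict H) < 2 * E₀ := by
    have : E₀ < 2 * E₀ := by
      rw [two_mul]
      exact ENNReal.lt_add_right hE₀fin h0
    simpa only [hE₀, iInf_lt_iff, exists_prop] using this
  set e : ℝ := E₀.toReal with he
  have he0 : 0 < e := ENNReal.toReal_pos h0 hE₀fin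
  have hee : ‖e‖ₑ = E₀ := by rw [Real.enorm_of_nonneg he0.le, he, ENNReal.ofReal_toReal hE₀fin]
  have heinv : ‖e⁻¹‖ₑ = E₀⁻¹ := by
    rw [← hee, Real.enorm_of_nonneg he0.le, Real.enorm_of_nonneg (inv_pos.2 he0).le,
      ENNReal.ofReal_inv_of_pos he0]
  set g' : (Fin n → ℝ) → ℝ := fun x => e⁻¹ * (g x - MvPolynomial.eval x P₀) with hg'
  have hg'm : Measurable g' := (measurable_sub_eval hg P₀).const_mul _
  have hg'2 : eLpNorm g' p (volume.restrict H) ≤ 2 := by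
    rw [show g' = e⁻¹ • (fun x => g x - MvPolynomial.eval x P₀) from rfl, eLpNorm_const_smul,
      heinv]
    calc E₀⁻¹ * _ ≤ E₀⁻¹ * (2 * E₀) := mul_le_mul_right hlt.le _
      _ = 2 := by rw [mul_left_comm, ENNReal.inv_mul_cancel h0 hE₀fin, mul_one]
  have hg'd : DiffBound H r g' p (E₀⁻¹ * ω) := by
    have := (hd.sub_coordPoly hP₀).const_mul e⁻¹
    rwa [heinv] at this
  have hnot : ¬ E₀⁻¹ * ω ≤ η := by
    intro hle
    obtain ⟨P₁, hP₁, hhalf⟩ := hη hH hHc hHD hst hg'm hg'2 (fun i u => (hg'd i u).trans hle)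
    have h1 : E₀ ≤ eLpNorm (fun x => g x - MvPolynomial.eval x (P₀ + MvPolynomial.C e * P₁)) p
        (volume.restrict H) :=
      iInf₂_le _ (add_mem_coordPoly hP₀ (C_mul_mem_coordPoly hP₁ e))
    have h2 : (fun x => g x - MvPolynomial.eval x (P₀ + MvPolynomial.C e * P₁))
        = e • fun x => g' x - MvPolynomial.eval x P₁ := by
      ext x
      simp only [hg', map_add, map_mul, MvPolynomial.eval_C, Pi.smul_apply, smul_eq_mul, mul_sub]
      rw [mul_inv_cancel_left₀ he0.ne', mul_inv_cancel_left₀ he0.ne']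
      ring
    rw [h2, eLpNorm_const_smul, hee] at h1
    have h3 : E₀ ≤ E₀ * (1 / 2) := h1.trans (mul_le_mul_right hhalf _)
    rw [one_div, ← div_eq_mul_inv] at h3
    exact absurd h3 (not_le.2 (ENNReal.half_lt_self h0 hE₀fin))
  rw [not_le] at hnot
  have h1 : E₀ * η ≤ ω := by
    calc E₀ * η ≤ E₀ * (E₀⁻¹ * ω) := mul_le_mul_right hnot.le _
      _ = ω := by rw [← mul_assoc, ENNReal.mul_inv_cancel h0 hE₀fin, one_mul]
  rcases eq_or_ne η ∞ with h | hηfin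
  · rw [h] at hnot
    exact absurd hnot not_top_lt
  · rw [mul_comm, ← div_eq_mul_inv, ENNReal.le_div_iff_mul_le (Or.inl hη0) (Or.inl hηfin)]
    exact h1

/-! ### From coordinate differences to the directional modulus. -/

open DirectionalWhitney

theorem finDiff_zero_step {V : Type*} [AddCommGroup V] [Module ℝ V] {r : ℕ} (hr : 1 ≤ r) (f : V → ℝ)
    (x : V) : finDiff r 0 f x = 0 := by
  have h := finDiff_polynomial (r := r) (q := Polynomial.C (f x))
    (Polynomial.degree_C_le.trans_lt (by exact_mod_cast hr)) 0 0
  rw [← h]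
  simp [finDiff]

theorem finDiff_neg_step {V : Type*} [AddCommGroup V] [Module ℝ V] (r : ℕ) (v : V) (f : V → ℝ)
    (x : V) : finDiff r (-v) f x = (-1) ^ r * finDiff r v f (x + (r : ℝ) • (-v)) := by
  rw [finDiff, finDiff, Finset.mul_sum, ← Finset.sum_range_reflect]
  refine Finset.sum_congr rfl fun j hj => ?_
  have hj' : j ≤ r := Nat.lt_succ_iff.1 (Finset.mem_range.1 hj)
  have h1 : r + 1 - 1 - j = r - j := by omega
  have h2 : x + ((r - j : ℕ) : ℝ) • (-v) = x + (r : ℝ) • (-v) + (j : ℝ) • v := by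
    rw [Nat.cast_sub hj', sub_smul, smul_neg (j : ℝ)]; abel
  have h3 : (-1 : ℝ) ^ (r + (r - j)) = (-1) ^ r * (-1) ^ (r + j) := by
    rw [← pow_add, show r + (r + j) = (r + (r - j)) + 2 * j by omega,
      pow_add _ _ (2 * j), pow_mul _ 2 j]
    simp
  rw [h1, h2, h3, Nat.choose_symm hj']
  ring

/-- The modulus only sees steps `0 < u ≤ diam G`. Negative steps reduce to positive ones by
reversing the segment, the zero step gives the zero difference since `r ≥ 1`, and for larger steps
no segment fits in `G`. -/
theorem eLpNorm_finDiff_le_modulus {n r : ℕ} (hr : 1 ≤ r) {f : EuclideanSpace ℝ (Fin n) → ℝ}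
    {p : ℝ≥0∞} {G 𝓔 : Set (EuclideanSpace ℝ (Fin n))} (hG : Convex ℝ G) (hGc : IsCompact G)
    (h𝓔 : ∀ e ∈ 𝓔, ‖e‖ = 1) {e : EuclideanSpace ℝ (Fin n)} (he : e ∈ 𝓔) (u : ℝ) :
    eLpNorm (finDiff r (u • e) f) p (volume.restrict {x | x ∈ G ∧ x + (r : ℝ) • u • e ∈ G})
      ≤ modulus r f G 𝓔 p := by
  have hDm : ∀ v : EuclideanSpace ℝ (Fin n), MeasurableSet {x | x ∈ G ∧ x + (r : ℝ) • v ∈ G} :=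
    fun v => hGc.measurableSet.inter
      (hGc.measurableSet.preimage (measurable_add_const _))
  have hr1 : (1 : ℝ) ≤ r := by exact_mod_cast hr
  have hpos : ∀ u : ℝ, 0 < u → eLpNorm (finDiff r (u • e) f) p
      (volume.restrict {x | x ∈ G ∧ x + (r : ℝ) • u • e ∈ G}) ≤ modulus r f G 𝓔 p := by
    intro u hu
    rcases le_or_gt u (Metric.diam G) with hud | hud
    · have h1 : eLpNorm (finDiff r (u • e) f) p
          (volume.restrict {x | x ∈ G ∧ x + (r : ℝ) • u • e ∈ G})
          = eLpNorm (fdiffOn r (u • e) f G) p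
          (volume.restrict {x | x ∈ G ∧ x + (r : ℝ) • u • e ∈ G}) := by
        refine eLpNorm_congr_ae ?_
        filter_upwards [ae_restrict_mem (hDm _)] with x hx
        rw [fdiffOn, if_pos (hG.segment_subset hx.1 hx.2)]
        rfl
      rw [h1]
      refine (eLpNorm_mono_measure _ (Measure.restrict_mono (fun x hx => hx.1) le_rfl)).trans ?_
      unfold modulus modulusAt
      refine le_iSup₂_of_le e he ?_
      exact le_iSup₂_of_le u ⟨hu, hud⟩ le_rfl
    · have : {x | x ∈ G ∧ x + (r : ℝ) • u • e ∈ G} = ∅ := by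
        refine eq_empty_of_forall_notMem fun x hx => ?_
        have h1 := Metric.dist_le_diam_of_mem hGc.isBounded hx.2 hx.1
        rw [dist_eq_norm, add_sub_cancel_left, norm_smul, norm_smul, h𝓔 e he, mul_one,
          Real.norm_of_nonneg (by positivity), Real.norm_of_nonneg hu.le] at h1
        nlinarith
      rw [this]
      simp
  rcases lt_trichotomy u 0 with hu | rfl | hu
  · have h1 : finDiff r (u • e) f = ((-1 : ℝ) ^ r) •
        fun x => finDiff r ((-u) • e) f (x + (r : ℝ) • u • e) := by
      ext x
      have := finDiff_neg_step r ((-u) • e) f x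
      rw [neg_smul, neg_neg] at this
      rw [this, neg_smul]
      rfl
    rw [h1, eLpNorm_const_smul]
    have h2 : ‖((-1 : ℝ) ^ r)‖ₑ = 1 := by
      rw [enorm_pow, enorm_neg, enorm_one, one_pow]
    rw [h2, one_mul]
    refine (eLpNorm_translate_le _ (fun x hx => ?_) (finDiff r ((-u) • e) f) p).trans
      (hpos (-u) (by linarith))
    refine And.intro hx.2 ?_
    have : x + (r : ℝ) • u • e + (r : ℝ) • (-u) • e = x := by
      rw [neg_smul, smul_neg]; abel
    rw [this]
    exact hx.1
  · have h1 : finDiff r ((0 : ℝ) • e) f = 0 := by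
      ext x
      rw [zero_smul, finDiff_zero_step hr]
      rfl
    rw [h1]
    simp
  · exact hpos u hu

/-- Allows `f` to be replaced by a measurable representative: by convexity every sampled point lies
in `G`, and translations preserve null sets. -/
theorem finDiff_congr_ae {n r : ℕ} {f f₀ : EuclideanSpace ℝ (Fin n) → ℝ}
    {G : Set (EuclideanSpace ℝ (Fin n))} (hG : Convex ℝ G) (hGm : MeasurableSet G)
    (hff : f =ᵐ[volume.restrict G] f₀) (v : EuclideanSpace ℝ (Fin n)) :
    finDiff r v f =ᵐ[volume.restrict {x | x ∈ G ∧ x + (r : ℝ) • v ∈ G}] finDiff r v f₀ := by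
  have hDm : MeasurableSet {x | x ∈ G ∧ x + (r : ℝ) • v ∈ G} :=
    hGm.inter (hGm.preimage (measurable_add_const _))
  have h1 : ∀ j ∈ Finset.range (r + 1), ∀ᵐ x ∂(volume.restrict
      {x | x ∈ G ∧ x + (r : ℝ) • v ∈ G}), f (x + (j : ℝ) • v) = f₀ (x + (j : ℝ) • v) := by
    intro j hj
    rw [Filter.EventuallyEq, ae_restrict_iff' hGm] at hff
    have h2 := (measurePreserving_add_right volume ((j : ℝ) • v)).quasiMeasurePreserving.ae hff
    rw [ae_restrict_iff' hDm]
    filter_upwards [h2] with x hx hxD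
    refine hx ?_
    rcases Nat.eq_zero_or_pos r with rfl | hr
    · have : j = 0 := by simpa using hj
      simpa [this] using hxD.1
    have hr0 : (0 : ℝ) < r := by exact_mod_cast hr
    have hjr : (j : ℝ) / r ≤ 1 := by
      rw [div_le_one hr0]
      exact_mod_cast Nat.lt_succ_iff.1 (Finset.mem_range.1 hj)
    have h1 := hG.add_smul_sub_mem hxD.1 hxD.2 ⟨by positivity, hjr⟩
    rwa [add_sub_cancel_left, smul_smul, div_mul_cancel₀ _ hr0.ne'] at h1
  filter_upwards [(Filter.eventually_all_finset _).2 h1] with x hx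
  unfold finDiff
  exact Finset.sum_congr rfl fun j hj => by rw [hx j hj]

/-- Composition of a polynomial with an affine map. -/
theorem exists_eval_eq_eval_affine {n : ℕ} (P : MvPolynomial (Fin n) ℝ)
    (L : EuclideanSpace ℝ (Fin n) →ₗ[ℝ] (Fin n → ℝ)) (c : Fin n → ℝ) :
    ∃ Q : MvPolynomial (Fin n) ℝ, ∀ x : EuclideanSpace ℝ (Fin n),
      MvPolynomial.eval (fun i => x i) Q = MvPolynomial.eval (L x + c) P := by
  classical
  refine ⟨MvPolynomial.bind₁ (fun i => (∑ k, MvPolynomial.C (L (EuclideanSpace.single k 1) i) *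
    MvPolynomial.X k) + MvPolynomial.C (c i)) P, fun x => ?_⟩
  have h1 : ∀ i, L x i = ∑ k, L (EuclideanSpace.single k 1) i * x k := by
    intro i
    have hx : x = ∑ k, x k • EuclideanSpace.single k (1 : ℝ) := by
      ext i
      simp [Pi.single_apply]
    conv_lhs => rw [hx]
    rw [map_sum, Finset.sum_apply]
    refine Finset.sum_congr rfl fun k _ => ?_
    rw [map_smul, Pi.smul_apply, smul_eq_mul, mul_comm]
  have h2 := MvPolynomial.eval₂Hom_bind₁ (RingHom.id ℝ) (fun i => x i)
    (fun i => (∑ k, MvPolynomial.C (L (EuclideanSpace.single k 1) i) *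
    MvPolynomial.X k) + MvPolynomial.C (c i)) P
  refine h2.trans ?_
  rw [MvPolynomial.eval]
  congr 1
  congr 1
  ext i
  simp [h1]

theorem exists_le_abs_inner_of_le_eps0 {n : ℕ} {𝓔 : Finset (EuclideanSpace ℝ (Fin n))}
    (hne : 𝓔.Nonempty) {ξ : EuclideanSpace ℝ (Fin n)} (hξ : ‖ξ‖ = 1) :
    ∃ e ∈ 𝓔, eps0 (𝓔 : Set (EuclideanSpace ℝ (Fin n))) ≤ |inner ℝ ξ e| := by
  have : Nonempty (𝓔 : Set (EuclideanSpace ℝ (Fin n))) := hne.to_subtype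
  obtain ⟨η, hη⟩ := exists_eq_ciSup_of_finite
    (f := fun η : (𝓔 : Set (EuclideanSpace ℝ (Fin n))) =>
      |inner ℝ ξ (η : EuclideanSpace ℝ (Fin n))|)
  refine ⟨η, η.2, ?_⟩
  rw [hη]
  exact ciInf_le (f := fun ξ : Metric.sphere (0 : EuclideanSpace ℝ (Fin n)) 1 =>
    ⨆ η : (𝓔 : Set (EuclideanSpace ℝ (Fin n))),
      |inner ℝ (ξ : EuclideanSpace ℝ (Fin n)) (η : EuclideanSpace ℝ (Fin n))|)
    ⟨0, by rintro _ ⟨ξ, rfl⟩; exact Real.iSup_nonneg fun _ => abs_nonneg _⟩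
    (⟨ξ, by simpa using hξ⟩ : Metric.sphere (0 : EuclideanSpace ℝ (Fin n)) 1)

/-! ### Cone geometry and the affine change of variables. -/

/-- Deep inside a wide cone there are `r` equidistant points on a line with direction `e`. -/
theorem closedBall_subset_of_cone {n r : ℕ} (hr : 1 ≤ r) {G : Set (EuclideanSpace ℝ (Fin n))}
    {v u e : EuclideanSpace ℝ (Fin n)} {h lam ε σ : ℝ} (hh : 0 < h) (hε : 0 < ε)
    (hu : ‖u‖ = 1) (he : ‖e‖ = 1) (hσ : σ = 1 ∨ σ = -1) (hσe : ε ≤ σ * inner ℝ e u)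
    (hlam : lam ≤ ε / 4) (hcone : cone v u h lam ⊆ G) {j : ℕ} (hj : j ∈ Finset.Icc 1 r) :
    Metric.closedBall (v + (j : ℝ) • (σ * (h / (2 * r))) • e) (h / (2 * r) * ε / 4) ⊆ G := by
  have hr1 : (1 : ℝ) ≤ r := by exact_mod_cast hr
  have hr0 : (0 : ℝ) < r := by linarith
  have hj1 : (1 : ℝ) ≤ j := by exact_mod_cast (Finset.mem_Icc.1 hj).1
  have hjr : (j : ℝ) ≤ r := by exact_mod_cast (Finset.mem_Icc.1 hj).2
  set s : ℝ := h / (2 * r) with hs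
  have hs0 : 0 < s := by positivity
  have hrs : r * s = h / 2 := by rw [hs]; field_simp
  have hσa : |σ| = 1 := by rcases hσ with rfl | rfl <;> simp
  set c : ℝ := σ * inner ℝ e u with hc
  have hc1 : c ≤ 1 := by
    have h1 := abs_real_inner_le_norm e u
    rw [hu, he, mul_one] at h1
    refine (le_abs_self c).trans ?_
    rw [hc, abs_mul, hσa, one_mul]
    exact h1
  intro y hy
  set w : EuclideanSpace ℝ (Fin n) := y - (v + (j : ℝ) • (σ * s) • e) with hw
  have hwn : ‖w‖ ≤ s * ε / 4 := by rwa [Metric.mem_closedBall, dist_eq_norm] at hy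
  have hwu : |inner ℝ w u| ≤ s * ε / 4 := by
    have h1 := abs_real_inner_le_norm w u
    rw [hu, mul_one] at h1
    exact h1.trans hwn
  obtain ⟨hw1, hw2⟩ := abs_le.1 hwu
  set x : EuclideanSpace ℝ (Fin n) := (j : ℝ) • (σ * s) • e + w with hx
  have hxu : inner ℝ x u = j * s * c + inner ℝ w u := by
    rw [hx, inner_add_left, real_inner_smul_left, real_inner_smul_left, hc]
    ring
  have hxn : ‖x‖ ≤ j * s + s * ε / 4 := by
    refine (norm_add_le _ _).trans (add_le_add (le_of_eq ?_) hwn)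
    rw [norm_smul, norm_smul, he, mul_one, Real.norm_of_nonneg (by positivity), norm_mul,
      Real.norm_eq_abs, hσa, one_mul, Real.norm_of_nonneg hs0.le]
  have hε1 : ε ≤ 1 := hσe.trans hc1
  have hsε : s * ε ≤ s := mul_le_of_le_one_right hs0.le hε1
  have hjs : s ≤ j * s := le_mul_of_one_le_left hs0.le hj1
  have hjrs : j * s ≤ r * s := by gcongr
  have hjsε : s * ε ≤ j * s * ε := by gcongr
  have hjsc : j * s * ε ≤ j * s * c := by gcongr
  have hjsc1 : j * s * c ≤ j * s := mul_le_of_le_one_right (by positivity) hc1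
  -- With `s = h / (2 * r)`, the component of `x` along `u` is at least `(3 / 4) * j * s * ε`, while
  -- `lam * ‖x‖` is at most `(5 / 16) * j * s * ε`. The height stays below `h / 2 + s / 4 ≤ h`.
  refine hcone ⟨x, ?_, ?_, ?_⟩
  · rw [hxu]
    calc lam * ‖x‖ ≤ ε / 4 * (j * s + s * ε / 4) := by gcongr
      _ ≤ _ := by nlinarith
  · rw [hxu]
    linarith
  · rw [hx, hw]; abel

/-- The vector `w` representing a coordinate functional pairs with the basis to `0` or `1`. Testing
the hypothesis on `w / ‖w‖` therefore gives `ε ≤ 1 / ‖w‖`. -/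
theorem norm_coord_le {n : ℕ} (b : Module.Basis (Fin n) ℝ (EuclideanSpace ℝ (Fin n))) {ε : ℝ}
    (hε : 0 < ε)
    (h : ∀ ξ : EuclideanSpace ℝ (Fin n), ‖ξ‖ = 1 → ∃ i, ε ≤ |inner ℝ ξ (b i)|)
    (x : EuclideanSpace ℝ (Fin n)) : ‖b.equivFun x‖ ≤ ‖x‖ / ε := by
  refine (pi_norm_le_iff_of_nonneg (by positivity)).2 fun i => ?_
  set φ : EuclideanSpace ℝ (Fin n) →L[ℝ] ℝ := LinearMap.toContinuousLinearMap (b.coord i) with hφ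
  set w := (InnerProductSpace.toDual ℝ (EuclideanSpace ℝ (Fin n))).symm φ with hw
  have hwx : ∀ y, inner ℝ w y = b.coord i y := fun y => by
    rw [hw, InnerProductSpace.toDual_symm_apply]; rfl
  have hw0 : 0 < ‖w‖ := by
    rw [norm_pos_iff]
    intro h0
    have := hwx (b i)
    rw [h0, inner_zero_left] at this
    simp at this
  have hwn : ‖w‖ * ε ≤ 1 := by
    obtain ⟨k, hk⟩ := h (‖w‖⁻¹ • w) (by
      rw [norm_smul, norm_inv, norm_norm, inv_mul_cancel₀ hw0.ne'])
    rw [real_inner_smul_left, hwx, abs_mul, abs_of_pos (inv_pos.2 hw0), le_inv_mul_iff₀ hw0] at hk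
    refine hk.trans ?_
    rw [Module.Basis.coord_apply, Module.Basis.repr_self, Finsupp.single_apply]
    split_ifs <;> simp
  have h1 : b.equivFun x i = inner ℝ w x := by rw [hwx]; rfl
  rw [h1, le_div_iff₀ hε]
  calc ‖inner ℝ w x‖ * ε ≤ ‖w‖ * ‖x‖ * ε := by
        gcongr
        exact norm_inner_le_norm w x
    _ = (‖w‖ * ε) * ‖x‖ := by ring
    _ ≤ 1 * ‖x‖ := by gcongr
    _ = ‖x‖ := one_mul _

theorem norm_equivFun_symm_le {n : ℕ} (b : Module.Basis (Fin n) ℝ (EuclideanSpace ℝ (Fin n)))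
    (hb : ∀ i, ‖b i‖ = 1) (t : Fin n → ℝ) : ‖b.equivFun.symm t‖ ≤ n * ‖t‖ := by
  rw [Module.Basis.equivFun_symm_apply]
  refine (norm_sum_le _ _).trans ?_
  calc ∑ i, ‖t i • b i‖ ≤ ∑ _i : Fin n, ‖t‖ := Finset.sum_le_sum fun i _ => by
        rw [norm_smul, hb, mul_one]; exact norm_le_pi_norm t i
    _ = n * ‖t‖ := by simp

/-- The affine parametrization `t ↦ y₀ + ρ ∑ i, t i • b i`. -/
noncomputable def param {n : ℕ} (b : Module.Basis (Fin n) ℝ (EuclideanSpace ℝ (Fin n)))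
    (y₀ : EuclideanSpace ℝ (Fin n)) (ρ : ℝ) (t : Fin n → ℝ) : EuclideanSpace ℝ (Fin n) :=
  y₀ + ρ • b.equivFun.symm t

theorem param_add_smul_single {n : ℕ} (b : Module.Basis (Fin n) ℝ (EuclideanSpace ℝ (Fin n)))
    (y₀ : EuclideanSpace ℝ (Fin n)) (ρ : ℝ) (t : Fin n → ℝ) (i : Fin n) (c u : ℝ) :
    param b y₀ ρ (t + c • Pi.single i u) = param b y₀ ρ t + c • (ρ * u) • b i := by
  have : b.equivFun.symm (Pi.single i u) = u • b i := by
    rw [Module.Basis.equivFun_symm_apply, Finset.sum_eq_single i]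
    · simp
    · intro k _ hk; simp [hk]
    · simp
  rw [param, param, map_add, map_smul, this, smul_add, add_assoc]
  congr 2
  simp only [smul_smul]
  congr 1
  ring

/-- The image of Lebesgue measure under the affine map is a constant multiple of Lebesgue measure.
The factor `κ` may depend on the basis, but it is the same for all functions and sets, so it cancels
from the final inequality. -/
theorem exists_eLpNorm_param {n : ℕ} (b : Module.Basis (Fin n) ℝ (EuclideanSpace ℝ (Fin n)))
    (y₀ : EuclideanSpace ℝ (Fin n)) {ρ : ℝ} (hρ : ρ ≠ 0) (p : ℝ≥0∞) :
    ∃ κ : ℝ≥0∞, κ ≠ 0 ∧ κ ≠ ∞ ∧ ∀ (S : Set (EuclideanSpace ℝ (Fin n)))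
      (φ : EuclideanSpace ℝ (Fin n) → ℝ),
      eLpNorm (fun t => φ (param b y₀ ρ t)) p (volume.restrict (param b y₀ ρ ⁻¹' S))
        = κ * eLpNorm φ p (volume.restrict S) := by
  let L : (Fin n → ℝ) ≃L[ℝ] EuclideanSpace ℝ (Fin n) :=
    (b.equivFun.symm.trans (LinearEquiv.smulOfNeZero ℝ _ ρ hρ)).toContinuousLinearEquiv
  have hpar : param b y₀ ρ = (fun x => y₀ + x) ∘ L := rfl
  have hemb : MeasurableEmbedding (param b y₀ ρ) := by
    rw [hpar]
    exact (measurableEmbedding_addLeft y₀).comp L.toHomeomorph.measurableEmbedding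
  have : (Measure.map L volume).IsAddHaarMeasure := L.isAddHaarMeasure_map volume
  obtain ⟨c, hc0, hc, hcμ⟩ : ∃ c : ℝ≥0∞, c ≠ 0 ∧ c ≠ ∞ ∧
      Measure.map L volume = c • (volume : Measure (EuclideanSpace ℝ (Fin n))) :=
    ⟨(Measure.addHaarScalarFactor (Measure.map L volume) volume : ℝ≥0),
      ENNReal.coe_ne_zero.2 (Measure.addHaarScalarFactor_pos_of_isAddHaarMeasure _ _).ne',
      ENNReal.coe_ne_top, Measure.isAddLeftInvariant_eq_smul _ _⟩
  have hmap : Measure.map (param b y₀ ρ) volume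
      = c • (volume : Measure (EuclideanSpace ℝ (Fin n))) := by
    rw [hpar, ← Measure.map_map (measurable_const_add y₀) L.continuous.measurable, hcμ,
      Measure.map_smul, map_add_left_eq_self]
  refine ⟨c ^ (1 / p).toReal, ?_, ?_, fun S φ => ?_⟩
  · simp [ENNReal.rpow_eq_zero_iff, hc0, hc]
  · exact ENNReal.rpow_ne_top_of_nonneg ENNReal.toReal_nonneg hc
  · rw [show (fun t => φ (param b y₀ ρ t)) = φ ∘ param b y₀ ρ from rfl,
      ← hemb.eLpNorm_map_measure, ← hemb.restrict_map, hmap, Measure.restrict_smul,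
      eLpNorm_smul_measure_of_ne_zero hc0, smul_eq_mul]

theorem exists_dirPoly_param {n r : ℕ} (b : Module.Basis (Fin n) ℝ (EuclideanSpace ℝ (Fin n)))
    (y₀ : EuclideanSpace ℝ (Fin n)) {ρ : ℝ} (hρ : ρ ≠ 0) {P : MvPolynomial (Fin n) ℝ}
    (hP : P ∈ coordPoly n r) :
    ∃ Q ∈ dirPoly r (range b), ∀ t, MvPolynomial.eval (fun i => param b y₀ ρ t i) Q
      = MvPolynomial.eval t P := by
  obtain ⟨Q, hQ⟩ := exists_eval_eq_eval_affine P (ρ⁻¹ • b.equivFun.toLinearMap)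
    (-(ρ⁻¹ • b.equivFun y₀))
  have hQ' : ∀ x : EuclideanSpace ℝ (Fin n), MvPolynomial.eval (fun i => x i) Q
      = MvPolynomial.eval (ρ⁻¹ • b.equivFun (x - y₀)) P := by
    intro x
    rw [hQ, map_sub, smul_sub, sub_eq_add_neg]
    rfl
  refine ⟨Q, ?_, fun t => ?_⟩
  · rintro x _ ⟨i, rfl⟩
    obtain ⟨q, hq, hqe⟩ := hP (ρ⁻¹ • b.equivFun (x - y₀)) i
    refine ⟨q.comp (Polynomial.C ρ⁻¹ * Polynomial.X), ?_, fun t => ?_⟩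
    · rcases eq_or_ne q 0 with rfl | hq0
      · simp
      · refine Polynomial.degree_le_natDegree.trans_lt ?_
        refine lt_of_le_of_lt ?_ (by rwa [Polynomial.degree_eq_natDegree hq0] at hq)
        have h1 : (q.comp (Polynomial.C ρ⁻¹ * Polynomial.X)).natDegree ≤ q.natDegree := by
          refine Polynomial.natDegree_comp_le.trans ?_
          exact mul_le_of_le_one_right (Nat.zero_le _) (by compute_degree)
        exact_mod_cast h1
    · rw [hQ', add_sub_right_comm, map_add, smul_add, map_smul]
      have : ρ⁻¹ • t • b.equivFun (b i) = Pi.single i (ρ⁻¹ * t) := by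
        ext j
        rw [Pi.smul_apply, Pi.smul_apply, Module.Basis.equivFun_self]
        rcases eq_or_ne j i with rfl | hj
        · simp
        · simp [hj, hj.symm]
      rw [this, hqe]
      simp
  · rw [hQ', param, add_sub_cancel_left, map_smul, smul_smul, inv_mul_cancel₀ hρ, one_smul,
      LinearEquiv.apply_symm_apply]

/-- The Whitney inequality for directions given by a basis. -/
theorem bestError_le_of_basis {n r : ℕ} (hr : 1 ≤ r) {p : ℝ≥0∞}
    {G : Set (EuclideanSpace ℝ (Fin n))} (hG : Convex ℝ G) (hGc : IsCompact G)
    (b : Module.Basis (Fin n) ℝ (EuclideanSpace ℝ (Fin n))) (hb : ∀ i, ‖b i‖ = 1)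
    (y₀ : EuclideanSpace ℝ (Fin n)) {ρ : ℝ} (hρ : ρ ≠ 0) {C : ℝ≥0}
    (hC : ∀ {g : (Fin n → ℝ) → ℝ} {ω E : ℝ≥0∞}, Measurable g →
      eLpNorm g p (volume.restrict (param b y₀ ρ ⁻¹' G)) ≠ ∞ →
      DiffBound (param b y₀ ρ ⁻¹' G) r g p ω →
      (∀ P ∈ coordPoly n r, E ≤ eLpNorm (fun x => g x - MvPolynomial.eval x P) p
        (volume.restrict (param b y₀ ρ ⁻¹' G))) → E ≤ C * ω)
    {f : EuclideanSpace ℝ (Fin n) → ℝ} (hf : MemLp f p (volume.restrict G)) :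
    bestError r f (range b) p G ≤ C * modulus r f G (range b) p := by
  obtain ⟨κ, hκ0, hκ, hκn⟩ := exists_eLpNorm_param b y₀ hρ p
  set f₀ := hf.1.mk f with hf₀
  have hf₀m : Measurable f₀ := hf.1.stronglyMeasurable_mk.measurable
  have hff₀ : f =ᵐ[volume.restrict G] f₀ := hf.1.ae_eq_mk
  have hpm : Measurable (param b y₀ ρ) := by
    unfold param
    exact ((LinearMap.continuous_of_finiteDimensional
      b.equivFun.symm.toLinearMap).measurable.const_smul ρ).const_add y₀
  have key := hC (g := fun t => f₀ (param b y₀ ρ t)) (ω := κ * modulus r f G (range b) p)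
    (E := κ * bestError r f (range b) p G) (hf₀m.comp hpm) ?_ ?_ ?_
  · rw [mul_left_comm] at key
    exact (ENNReal.mul_le_mul_iff_right hκ0 hκ).1 key
  · rw [hκn, ← eLpNorm_congr_ae hff₀]
    exact ENNReal.mul_ne_top hκ hf.2.ne
  · intro i u
    have h1 : finDiff r (Pi.single i u) (fun t => f₀ (param b y₀ ρ t))
        = fun t => finDiff r ((ρ * u) • b i) f₀ (param b y₀ ρ t) := by
      ext t
      simp only [finDiff, param_add_smul_single]
    have h2 : {x | x ∈ param b y₀ ρ ⁻¹' G ∧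
        x + (r : ℝ) • Pi.single i u ∈ param b y₀ ρ ⁻¹' G} = param b y₀ ρ ⁻¹'
        {x | x ∈ G ∧ x + (r : ℝ) • (ρ * u) • b i ∈ G} := by
      ext t
      change _ ∧ param b y₀ ρ _ ∈ G ↔ _
      rw [param_add_smul_single]
      rfl
    rw [h1, h2, hκn, ← eLpNorm_congr_ae (finDiff_congr_ae hG hGc.measurableSet hff₀ _)]
    refine mul_le_mul_right (eLpNorm_finDiff_le_modulus hr hG hGc ?_ (mem_range_self i) _) _
    rintro _ ⟨i, rfl⟩
    exact hb i
  · intro P hP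
    obtain ⟨Q, hQ, hQP⟩ := exists_dirPoly_param b y₀ hρ hP
    have h1 : (fun t => f₀ (param b y₀ ρ t) - MvPolynomial.eval t P)
        = fun t => (fun x : EuclideanSpace ℝ (Fin n) =>
          f₀ x - MvPolynomial.eval (fun i => x i) Q) (param b y₀ ρ t) := by
      ext t
      simp only [hQP]
    rw [h1, hκn G fun x => f₀ x - MvPolynomial.eval (fun i => x i) Q]
    refine mul_le_mul_right ((iInf₂_le Q hQ).trans (le_of_eq (eLpNorm_congr_ae ?_))) _
    filter_upwards [hff₀] with x hx
    rw [hx]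

end CoordWhitney

/-! ### Assembly with uniform constants. -/

open DirectionalWhitney in
/-- The constant `C` is chosen after `d, r, p, h`, the diameter `D` and a lower bound `ε` for
`ε₀(𝓔)` only, and before `𝓔`, `lam`, `G` and `f`. -/
theorem mainTheorem12 (d r : ℕ) (hr : 1 ≤ r) (p : ℝ≥0∞) (hp : 0 < p) (h D ε : ℝ)
    (hh : 0 < h) (hε : 0 < ε) :
    ∃ C : ℝ≥0, ∀ (𝓔 : Finset (EuclideanSpace ℝ (Fin (d + 1)))) (lam : ℝ)
      (G : Set (EuclideanSpace ℝ (Fin (d + 1)))) (f : EuclideanSpace ℝ (Fin (d + 1)) → ℝ),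
      (∀ e ∈ 𝓔, ‖e‖ = 1) → 𝓔.card = d + 1 →
      Submodule.span ℝ (𝓔 : Set (EuclideanSpace ℝ (Fin (d + 1)))) = ⊤ →
      ε ≤ eps0 (𝓔 : Set (EuclideanSpace ℝ (Fin (d + 1)))) →
      Convex ℝ G → IsCompact G → (interior G).Nonempty → Metric.diam G = D →
      0 < lam → lam < eps0 (𝓔 : Set (EuclideanSpace ℝ (Fin (d + 1)))) / (4 * Real.sqrt r) →
      ConeCondition G h lam →
      MemLp f p (volume.restrict G) →
      bestError r f 𝓔 p G ≤ C * modulus r f G 𝓔 p := by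
  open CoordWhitney in
  have hr1 : (1 : ℝ) ≤ r := by exact_mod_cast hr
  set s : ℝ := h / (2 * r) with hs
  have hs0 : 0 < s := by positivity
  set δ : ℝ := s * ε / 4 with hδ
  have hδ0 : 0 < δ := by positivity
  -- Since `‖∑ t i • b i‖ ≤ (d + 1) * ‖t‖`, this scale makes the parametrization `δ`-Lipschitz, so
  -- sup-norm unit balls map into Euclidean balls of radius `δ`.
  set ρ : ℝ := δ / (d + 1 : ℕ) with hρ
  have hn0 : (0 : ℝ) < (d + 1 : ℕ) := by positivity
  have hρ0 : 0 < ρ := by positivity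
  -- Radius `D / (ρ * ε)` contains the preimage of `G` by `norm_coord_le`; a step `s` in `G` becomes
  -- `s / ρ`, and depth `δ` becomes depth `1`. All of these are independent of the directions.
  obtain ⟨C, hC⟩ := exists_whitney (n := d + 1) (Nat.succ_ne_zero d) hr hp.ne' (D / (ρ * ε))
    (s / ρ) one_pos
  refine ⟨C, fun 𝓔 lam G f h𝓔 hcard hspan heps hG hGc hGi hGD hlam hlam' hcone hf => ?_⟩
  set ε₀ := eps0 (𝓔 : Set (EuclideanSpace ℝ (Fin (d + 1)))) with hε₀
  have hε₀0 : 0 < ε₀ := hε.trans_le heps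
  have hne : 𝓔.Nonempty := Finset.card_pos.1 (by omega)
  -- Only this consequence of the bound with `√r` is used.
  have hlam4 : lam ≤ ε₀ / 4 := by
    refine hlam'.le.trans ?_
    have : 1 ≤ Real.sqrt r := Real.one_le_sqrt.2 hr1
    gcongr
    linarith
  let eqv := (𝓔.equivFinOfCardEq hcard).symm
  have hrange : range (fun i => (eqv i : EuclideanSpace ℝ (Fin (d + 1)))) = 𝓔 := by
    rw [show (fun i => (eqv i : EuclideanSpace ℝ (Fin (d + 1)))) = Subtype.val ∘ eqv from rfl,
      eqv.surjective.range_comp]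
    simp
  let b : Module.Basis (Fin (d + 1)) ℝ (EuclideanSpace ℝ (Fin (d + 1))) :=
    basisOfTopLeSpanOfCardEqFinrank (fun i => (eqv i : EuclideanSpace ℝ (Fin (d + 1))))
      (by rw [hrange, hspan]) (by simp)
  have hbcoe : ⇑b = fun i => (eqv i : EuclideanSpace ℝ (Fin (d + 1))) :=
    coe_basisOfTopLeSpanOfCardEqFinrank _ _ _
  have hbrange : range b = 𝓔 := by rw [hbcoe, hrange]
  have hb1 : ∀ i, ‖b i‖ = 1 := fun i => by rw [hbcoe]; exact h𝓔 _ (eqv i).2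
  have hbinner : ∀ ξ : EuclideanSpace ℝ (Fin (d + 1)), ‖ξ‖ = 1 →
      ∃ i, ε₀ ≤ |inner ℝ ξ (b i)| := by
    intro ξ hξ
    obtain ⟨e, he, hee⟩ := exists_le_abs_inner_of_le_eps0 hne hξ
    obtain ⟨i, rfl⟩ : e ∈ range b := by rw [hbrange]; exact he
    exact ⟨i, hee⟩
  have hdeep : ∀ v ∈ G, ∃ (i : Fin (d + 1)) (σ : ℝ), (σ = 1 ∨ σ = -1) ∧ ∀ j ∈ Finset.Icc 1 r,
      Metric.closedBall (v + (j : ℝ) • (σ * s) • b i) δ ⊆ G := by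
    intro v hv
    obtain ⟨u, hu, hcu⟩ := hcone v hv
    obtain ⟨i, hi⟩ := hbinner u hu
    obtain ⟨σ, hσ, hσi⟩ : ∃ σ : ℝ, (σ = 1 ∨ σ = -1) ∧ ε₀ ≤ σ * inner ℝ (b i) u := by
      rcases le_total 0 (inner ℝ (b i) u) with h0 | h0
      · exact ⟨1, Or.inl rfl, by
          rwa [real_inner_comm, abs_of_nonneg h0, ← one_mul (inner ℝ _ _)] at hi⟩
      · exact ⟨-1, Or.inr rfl, by rwa [real_inner_comm, abs_of_nonpos h0, ← neg_one_mul] at hi⟩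
    refine ⟨i, σ, hσ, fun j hj => ?_⟩
    refine (Metric.closedBall_subset_closedBall ?_).trans
      (closedBall_subset_of_cone hr hh hε₀0 hu (hb1 i) hσ hσi hlam4 hcu hj)
    rw [hδ]
    gcongr
  obtain ⟨v₀, hv₀⟩ := hGi.mono interior_subset
  obtain ⟨y₀, hy₀⟩ : ∃ y₀, Metric.closedBall y₀ δ ⊆ G := by
    obtain ⟨i, σ, -, hj⟩ := hdeep v₀ hv₀
    exact ⟨_, hj 1 (by simp [hr])⟩
  have hy₀G : y₀ ∈ G := hy₀ (Metric.mem_closedBall_self hδ0.le)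
  have hdist : ∀ t t', ‖param b y₀ ρ t - param b y₀ ρ t'‖ ≤ δ * ‖t - t'‖ := by
    intro t t'
    rw [param, param, add_sub_add_left_eq_sub, ← smul_sub, ← map_sub, norm_smul,
      Real.norm_of_nonneg hρ0.le]
    refine (mul_le_mul_of_nonneg_left (norm_equivFun_symm_le b hb1 (t - t')) hρ0.le).trans
      (le_of_eq ?_)
    rw [← mul_assoc, hρ, div_mul_cancel₀ _ hn0.ne']
  have hparam0 : param b y₀ ρ 0 = y₀ := by simp [param]
  have hHconv : Convex ℝ (param b y₀ ρ ⁻¹' G) := by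
    have h1 : param b y₀ ρ ⁻¹' G
        = (ρ • b.equivFun.symm.toLinearMap) ⁻¹' ((fun x => y₀ + x) ⁻¹' G) := rfl
    rw [h1]
    exact (hG.translate_preimage_right y₀).linear_preimage _
  rw [← hbrange]
  refine bestError_le_of_basis hr hG hGc b hb1 y₀ hρ0.ne' (C := C)
    (fun {g ω E} hg hfin hd hE => hC hHconv ?_ ?_ ?_ hg hfin hd hE) hf
  · intro t ht
    refine hy₀ ?_
    have h1 := hdist t 0
    rw [hparam0] at h1
    rw [Metric.mem_closedBall, dist_eq_norm]
    refine h1.trans (mul_le_of_le_one_right hδ0.le ?_)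
    rw [sub_zero]
    refine (pi_norm_le_iff_of_nonneg zero_le_one).2 fun i => ?_
    rw [Real.norm_of_nonneg (ht.1 i)]
    exact ht.2 i
  · intro t ht
    have h1 : ‖param b y₀ ρ t - y₀‖ ≤ D := by
      rw [← dist_eq_norm, ← hGD]
      exact Metric.dist_le_diam_of_mem hGc.isBounded ht hy₀G
    rw [param, add_sub_cancel_left, norm_smul, Real.norm_of_nonneg hρ0.le] at h1
    have h2 := norm_coord_le b hε (fun ξ hξ => (hbinner ξ hξ).imp fun i hi => heps.trans hi)
      (b.equivFun.symm t)
    rw [LinearEquiv.apply_symm_apply, le_div_iff₀ hε] at h2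
    rw [mem_closedBall_zero_iff, le_div_iff₀ (by positivity)]
    calc ‖t‖ * (ρ * ε) = ρ * (‖t‖ * ε) := by ring
      _ ≤ ρ * ‖b.equivFun.symm t‖ := by gcongr
      _ ≤ D := h1
  · intro t ht
    obtain ⟨i, σ, hσ, hj⟩ := hdeep _ ht
    refine ⟨i, σ, hσ, fun j hjr t' ht' => hj j hjr ?_⟩
    rw [Metric.mem_closedBall, dist_eq_norm] at ht' ⊢
    have h1 : param b y₀ ρ t + (j : ℝ) • (σ * s) • b i
        = param b y₀ ρ (t + (j : ℝ) • Pi.single i (σ * (s / ρ))) := by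
      rw [param_add_smul_single]
      congr 3
      field_simp
    rw [h1]
    exact (hdist _ _).trans (mul_le_of_le_one_right hδ0.le ht')
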